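/- **Setting.** Let $(\Omega,\mathcal A,\mathbb P)$ be a probability space with a filtration $\mathbb F=(\mathcal F_t)_{t\ge0}$, and let $\tau$ be a strictly positive finite random time. Let $\mathcal D_t=\bigcap_{s>t}\sigma(\tau\wedge s)$. Let $\delta(t)\in[0,t]$ be a function such that $t\mapsto t-\delta(t)$ is increasing, and put $$\mathcal F^D_t:=\mathcal F_{t-\delta(t)},\qquad \mathcal G^D_t:=\mathcal F_{t-\delta(t)}\vee\mathcal D_t .$$ Let $S$ be a càdlàg $\mathbb F$-adapted version of the Azéma supermartingale $S_t=\mathbb P(\tau>t\mid\mathcal F_t)$ (it exists under the usual conditions on $\mathbb F$). **Proposition.** (i) For every $t\ge 0$, $\mathbb E[S_t\mid\mathcal F^D_t]>0$ a.s. on $\{\tau>t\}$. For all $\theta\ge t$ and every $\mathcal F_\theta$-measurable random variable $\phi_\theta$ which is either real valued with $\phi_\theta\mathbf 1_{\{\tau>\theta\}}$ integrable (in which case $\phi_\theta S_\theta$ is integrable), or $[0,\infty]$-valued, one has almost surely $$\mathbb E[\phi_\theta\mathbf 1_{\{\tau>\theta\}}\mid\mathcal G^D_t]=\mathbf 1_{\{\tau>t\}}\,\frac{\mathbb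 E[\phi_\theta S_\theta\mid\mathcal F^D_t]}{\mathbb E[S_t\mid\mathcal F^D_t]} .$$ (ii) Let $T\ge0$, let $R$ be a strictly positive $\mathbb F$-predictable process, $C$ an $\mathcal F_T$-measurable random variable, $G$ an $\mathbb F$-adapted continuous process of locally finite variation with $G_0=0$, and $Z$ an $\mathbb F$-predictable process (all real valued). For $t\le T$ let $$V^D_t:=\mathbf 1_{\{\tau>t\}}\,\mathbb E\Big[\frac{R_t}{R_T}\,C\,\mathbf 1_{\{\tau>T\}}+\int_t^T\mathbf 1_{\{\tau>u\}}\frac{R_t}{R_u}\,dG_u+\frac{R_t}{R_\tau}Z_\tau\,\mathbf 1_{\{t<\tau\le T\}}\,\Big|\,\mathcal G^D_t\Big]$$ be the value process of the claim $(C,G,Z)$ for the delay-informed investor. Assume that $\frac{R_t}{R_T}C\mathbf 1_{\{\tau>T\}}$, $\int_t^T\mathbf 1_{\{\tau>u\}}\frac{R_t}{R_u}\,|dG_u|$ and $\frac{R_t}{R_\tau}Z_\tau\mathbf 1_{\{t<\tau\le T\}}$ are integrable, and that the process $H_u=\frac{R_t}{R_u}Z_u$ is integrable in mean with respect to $S$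 on $(t,T]$, i.e. the stochastic integrals of the bounded predictable processes $H\mathbf 1_{\{|H|\le n\}}$ with respect to $S$ over $(t,T]$ converge in $L^1(\mathbb P)$ as $n\to\infty$; the limit is denoted $\int_t^T\frac{R_t}{R_u}Z_u\,dS_u$. Then the cash flow in the definition of $V^D_t$ is integrable on $\{\tau>t\}$; almost surely $u\mapsto\frac{R_t}{R_u}S_u$ is integrable against $|dG|$ on $(t,T]$; the random variable in the conditional expectation on the right below is integrable; and almost surely $$V^D_t=\frac{\mathbf 1_{\{\tau>t\}}}{\mathbb E[S_t\mid\mathcal F^D_t]}\;\mathbb E\Big[\frac{R_t}{R_T}S_T\,C+\int_t^T\frac{R_t}{R_u}S_u\,dG_u-\int_t^T\frac{R_t}{R_u}Z_u\,dS_u\,\Big|\,\mathcal F^D_t\Big].$$ Here the stochastic integral of bounded predictable processes is the extension of the elementary integral $\int\xi\mathbf 1_{(s,v]}\,dS=\xi(S_v-S_s)$ ($\xi$ bounded, $\mathcal F_s$-measurable) that is additive and continuous along bounded pointwise convergent sequences of integrands. -/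

import Mathlib

open MeasureTheory Set Filter Topology
open scoped NNReal ENNReal

namespace DelayedInfo

noncomputable section

/-! ### Filtrations -/

/-- The filtration `𝓓⁰` with `𝓓⁰_t = σ(τ ∧ t)`. -/
def rawDefaultFiltration {Ω : Type*} {m : MeasurableSpace Ω} (τ : Ω → ℝ≥0) (hτ : Measurable τ) :
    Filtration ℝ≥0 m where
  seq t := MeasurableSpace.comap (fun ω => min (τ ω) t) inferInstance
  mono' := by
    intro s t hst
    have h : (fun ω => min (τ ω) s) = (fun x => min x s) ∘ (fun ω => min (τ ω) t) := by
      funext ω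
      simp [min_assoc, min_eq_right hst]
    change MeasurableSpace.comap (fun ω => min (τ ω) s) inferInstance ≤
      MeasurableSpace.comap (fun ω => min (τ ω) t) inferInstance
    rw [h, ← MeasurableSpace.comap_comp]
    exact MeasurableSpace.comap_mono
      (measurable_iff_comap_le.mp (measurable_id.min measurable_const))
  le' t := measurable_iff_comap_le.mp (hτ.min measurable_const)

/-- The filtration `𝓓` with `𝓓_t = 𝓓⁰_{t+}`, the smallest right-continuous filtration for which
`τ` is a stopping time. -/
def defaultFiltration {Ω : Type*} {m : MeasurableSpace Ω} (τ : Ω → ℝ≥0) (hτ : Measurable τ) :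
    Filtration ℝ≥0 m :=
  (rawDefaultFiltration τ hτ).rightCont

/-- The delayed filtration `𝓕ᴰ` with `𝓕ᴰ_t = 𝓕_{t - δ(t)}`. -/
def delayedFiltration {Ω : Type*} {m : MeasurableSpace Ω} (𝓕 : Filtration ℝ≥0 m)
    (δ : ℝ≥0 → ℝ≥0) (hδ : Monotone fun t => t - δ t) : Filtration ℝ≥0 m where
  seq t := 𝓕 (t - δ t)
  mono' _ _ hst := 𝓕.mono (hδ hst)
  le' t := 𝓕.le (t - δ t)

/-- The information flow `𝓖ᴰ` of the delay-informed investor: `𝓖ᴰ_t = 𝓕_{t - δ(t)} ∨ 𝓓_t`. -/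
def investorFiltration {Ω : Type*} {m : MeasurableSpace Ω} (𝓕 : Filtration ℝ≥0 m)
    (δ : ℝ≥0 → ℝ≥0) (hδ : Monotone fun t => t - δ t) (τ : Ω → ℝ≥0) (hτ : Measurable τ) :
    Filtration ℝ≥0 m :=
  delayedFiltration 𝓕 δ hδ ⊔ defaultFiltration τ hτ

/-! ### The Azéma supermartingale -/

/-- `S` is (the càdlàg version of) the Azéma supermartingale of `τ` with respect to `𝓕`:
an adapted process with right-continuous paths having left limits, and
`S_t = P(τ > t | 𝓕_t)` almost surely for each `t`. -/
structure IsAzemaSupermartingale {Ω : Type*} {m : MeasurableSpace Ω} (P : Measure Ω)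
    (𝓕 : Filtration ℝ≥0 m) (τ : Ω → ℝ≥0) (S : ℝ≥0 → Ω → ℝ) : Prop where
  adapted : StronglyAdapted 𝓕 S
  rightContinuous : ∀ ω t, ContinuousWithinAt (fun u => S u ω) (Ici t) t
  leftLimits : ∀ ω t, ∃ l : ℝ, Tendsto (fun u => S u ω) (𝓝[<] t) (𝓝 l)
  condExp : ∀ t, S t =ᵐ[P] P[{ω | t < τ ω}.indicator (fun _ => (1 : ℝ)) | 𝓕 t]

/-! ### Integration against a continuous function of finite variation -/

/-- The total variation measure `|dg|` of a continuous function `g` of locally finite variation. -/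
def variationMeasure (g : ℝ≥0 → ℝ) (hg : LocallyBoundedVariationOn g univ) : Measure ℝ≥0 :=
  (monotoneOn_univ.mp
    (variationOnFromTo.monotoneOn hg (mem_univ 0))).stieltjesFunction.measure

/-- The measure `|dg| - dg` (twice the negative part of `dg`) of a continuous function `g` of
locally finite variation. -/
def variationSubMeasure (g : ℝ≥0 → ℝ) (hg : LocallyBoundedVariationOn g univ) : Measure ℝ≥0 :=
  (monotoneOn_univ.mp
    (variationOnFromTo.sub_self_monotoneOn hg (mem_univ 0))).stieltjesFunction.measure

/-- The Lebesgue–Stieltjes integral `∫_(a,b] f dg` for a continuous function `g` of locally finite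
variation, as the difference of the integrals against the measures `|dg|` and `|dg| - dg`.
It is meaningful when `f` is integrable against `|dg|` on `(a,b]`. -/
def stieltjesIntegral (g : ℝ≥0 → ℝ) (hg : LocallyBoundedVariationOn g univ) (a b : ℝ≥0)
    (f : ℝ≥0 → ℝ) : ℝ :=
  (∫ u in Ioc a b, f u ∂(variationMeasure g hg)) -
    ∫ u in Ioc a b, f u ∂(variationSubMeasure g hg)

/-! ### Stochastic integration -/

/-- `HasBddStochIntegral P 𝓕 S a b K I`: the random variable `I` is (a version of) the stochastic
integral `∫_(a,b] K dS` of the bounded `𝓕`-predictable process `K`.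

As usual, this integral is the extension of the elementary integral
`∫ ξ 1_(s,v] dS = ξ (S_v - S_s)`, where `ξ` is bounded and `𝓕_s`-measurable, which is additive and
continuous along bounded pointwise convergent sequences of integrands. The convergence of the
integrals is convergence in mean; for the Azéma supermartingales considered here, integrals of
uniformly bounded integrands are bounded in `L²`, so that this is the same as convergence in
probability. Only the values of the integrand on `(a,b]` matter. -/
inductive HasBddStochIntegral {Ω : Type*} {m : MeasurableSpace Ω} (P : Measure Ω)
    (𝓕 : Filtration ℝ≥0 m) (S : ℝ≥0 → Ω → ℝ) (a b : ℝ≥0) :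
    (ℝ≥0 → Ω → ℝ) → (Ω → ℝ) → Prop
  | step (s v : ℝ≥0) (has : a ≤ s) (hsv : s ≤ v) (hvb : v ≤ b) (ξ : Ω → ℝ)
      (hξ : StronglyMeasurable[𝓕 s] ξ) (c : ℝ) (hc : ∀ ω, |ξ ω| ≤ c) :
      HasBddStochIntegral P 𝓕 S a b
        (fun u ω => (Ioc s v).indicator (fun _ => ξ ω) u)
        (fun ω => ξ ω * (S v ω - S s ω))
  | add (K K' : ℝ≥0 → Ω → ℝ) (I I' : Ω → ℝ)
      (h : HasBddStochIntegral P 𝓕 S a b K I) (h' : HasBddStochIntegral P 𝓕 S a b K' I') :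
      HasBddStochIntegral P 𝓕 S a b (fun u ω => K u ω + K' u ω) (fun ω => I ω + I' ω)
  | lim (Kn : ℕ → ℝ≥0 → Ω → ℝ) (In : ℕ → Ω → ℝ) (K : ℝ≥0 → Ω → ℝ) (I : Ω → ℝ) (c : ℝ)
      (h : ∀ n, HasBddStochIntegral P 𝓕 S a b (Kn n) (In n))
      (hbound : ∀ n, ∀ u ∈ Ioc a b, ∀ ω, |Kn n u ω| ≤ c)
      (hKlim : ∀ u ∈ Ioc a b, ∀ ω, Tendsto (fun n => Kn n u ω) atTop (𝓝 (K u ω)))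
      (hI : Integrable I P)
      (hIlim : Tendsto (fun n => eLpNorm (In n - I) 1 P) atTop (𝓝 0)) :
      HasBddStochIntegral P 𝓕 S a b K I

/-- `HasStochIntegral P 𝓕 S a b H I`: the predictable process `H` is integrable in mean with
respect to `S` on `(a,b]`, and `I` is (a version of) the stochastic integral `∫_(a,b] H dS`, that
is, the integrals of the truncations `H 1_{|H| ≤ n}` converge to `I` in mean. -/
def HasStochIntegral {Ω : Type*} {m : MeasurableSpace Ω} (P : Measure Ω)
    (𝓕 : Filtration ℝ≥0 m) (S : ℝ≥0 → Ω → ℝ) (a b : ℝ≥0) (H : ℝ≥0 → Ω → ℝ) (I : Ω → ℝ) : Prop :=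
  Integrable I P ∧ ∃ In : ℕ → Ω → ℝ,
    (∀ᶠ n : ℕ in atTop, HasBddStochIntegral P 𝓕 S a b
      (fun u ω => {x : ℝ | |x| ≤ n}.indicator id (H u ω)) (In n)) ∧
    Tendsto (fun n => eLpNorm (In n - I) 1 P) atTop (𝓝 0)

/-! ### The claim and its value -/

/-- The cash flows of the claim `(C, G, Z)` of maturity `T`, discounted to the date `t`:
`R_t (C R_T⁻¹ 1_{τ > T} + ∫_t^T 1_{τ > u} R_u⁻¹ dG_u + Z_τ 1_{τ ≤ T} R_τ⁻¹)`. -/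
def discountedCashFlow {Ω : Type*} (τ : Ω → ℝ≥0) (R : ℝ≥0 → Ω → ℝ) (C : Ω → ℝ)
    (G : ℝ≥0 → Ω → ℝ) (hG : ∀ ω, LocallyBoundedVariationOn (fun u => G u ω) univ)
    (Z : ℝ≥0 → Ω → ℝ) (T t : ℝ≥0) (ω : Ω) : ℝ :=
  R t ω * (C ω * (R T ω)⁻¹ * {ω | T < τ ω}.indicator (fun _ => (1 : ℝ)) ω
    + stieltjesIntegral (fun u => G u ω) (hG ω) t T
        (fun u => {ω | u < τ ω}.indicator (fun _ => (1 : ℝ)) ω * (R u ω)⁻¹)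
    + Z (τ ω) ω * {ω | τ ω ≤ T}.indicator (fun _ => (1 : ℝ)) ω * (R (τ ω) ω)⁻¹)

/-- The value at time `t`, before default, of the claim `(C, G, Z)` for an agent with information
flow `𝓗`: the conditional expectation given `𝓗_t` of the cash flows discounted to the date `t`,
on the event `{τ > t}` (which belongs to `𝓗_t`), and `0` off this event. The factor `R_t` of the
discounting is inside the conditional expectation, since it need not be `𝓗_t`-measurable. -/
def valueProcess {Ω : Type*} {m : MeasurableSpace Ω} (P : Measure Ω) (𝓗 : Filtration ℝ≥0 m)
    (τ : Ω → ℝ≥0) (R : ℝ≥0 → Ω → ℝ) (C : Ω → ℝ)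
    (G : ℝ≥0 → Ω → ℝ) (hG : ∀ ω, LocallyBoundedVariationOn (fun u => G u ω) univ)
    (Z : ℝ≥0 → Ω → ℝ) (T t : ℝ≥0) : Ω → ℝ :=
  P[{ω | t < τ ω}.indicator (discountedCashFlow τ R C G hG Z T t) | 𝓗 t]

end

end DelayedInfo

/-! Part (i) is Bayes' rule on the event E = {τ > t}. A set of 𝓓_t either contains E or misses it,
because τ ∧ s is constant equal to s on {τ ≥ s}. Hence 𝓖ᴰ_t and 𝓕ᴰ_t have the same trace on E, and
for X vanishing off E the conditional expectation given 𝓖ᴰ_t is 1_E · E[X | 𝓕ᴰ_t] / P(E | 𝓕ᴰ_t)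
(`IsCondDensity.condExp_eq_div`, `IsCondDensity.condLExp_eq_div`). Since S_θ is a density of A ↦ P(A
∩ {τ > θ}) on 𝓕_θ, and 𝓕ᴰ_t ⊆ 𝓕_t ⊆ 𝓕_θ, the tower property replaces survival indicators by S in
numerator and denominator. The denominator is positive a.s. on E because a density charges its
event.

For part (ii) the same quotient formula reduces everything to comparing integrals over sets of 𝓕_t,
one cash flow at a time. The terminal payment is the case θ = T.

For the dividends, |dG| and |dG| - dG are adapted increasing random measures. The survival indicator
and S have equal integrals against a predictable process times such a measure
(`lintegral_doleansMeasure_predictable_eq`): both processes are right-continuous, so they may be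
evaluated on a grid slightly to the right of the current time; there the mass of a cell is already
known, and the defining property of S applies cell by cell. Limits in the mesh, a monotone class
argument and a localisation in the total mass finish the proof.

For recovery, an elementary integral ξ (S_v - S_s) has the same integral over 𝓕_t-sets as -ξ 1_{s <
τ ≤ v}. This is minus the integrand evaluated at τ, and the identity survives sums, bounded limits
and truncation (`HasBddStochIntegral.integrable_and_setIntegral_eq`,
`HasStochIntegral.setIntegral_eq`). -/

namespace DelayedInfo

/-! ### Conditional densities of an event -/

section Density

variable {Ω : Type*} {m₁ m₀ m : MeasurableSpace Ω} {P : Measure Ω} {E : Set Ω}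

/-- `D` is a density on `m₀` of the measure `A ↦ P (A ∩ E)`. -/
def IsCondDensity (P : Measure[m] Ω) (m₀ : MeasurableSpace Ω) (E : Set Ω) (D : Ω → ℝ≥0∞) : Prop :=
  ∀ A, MeasurableSet[m₀] A → ∫⁻ ω in A, D ω ∂P = P (A ∩ E)

/-- The measures D·P and P restricted to E agree on m₀, so their trims to m₀ coincide and integrate
m₀-measurable functions equally; D itself need not be m₀-measurable. -/
theorem IsCondDensity.lintegral_mul {D : Ω → ℝ≥0∞} (hD : IsCondDensity P m₀ E D) (hm : m₀ ≤ m)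
    (hE : MeasurableSet E) (hDm : AEMeasurable D P) {f : Ω → ℝ≥0∞} (hf : Measurable[m₀] f) :
    ∫⁻ ω, f ω * D ω ∂P = ∫⁻ ω, E.indicator f ω ∂P := by
  have key : (P.withDensity D).trim hm = (P.restrict E).trim hm := by
    refine @Measure.ext _ m₀ _ _ fun A hA => ?_
    rw [trim_measurableSet_eq hm hA, trim_measurableSet_eq hm hA, withDensity_apply _ (hm A hA),
      Measure.restrict_apply (hm A hA), hD A hA]
  calc ∫⁻ ω, f ω * D ω ∂P = ∫⁻ ω, f ω ∂(P.withDensity D) := by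
        rw [lintegral_withDensity_eq_lintegral_mul₀ hDm (hf.mono hm le_rfl).aemeasurable]
        simp [mul_comm]
    _ = ∫⁻ ω, f ω ∂(P.restrict E) := by
        rw [← lintegral_trim hm hf, key, lintegral_trim hm hf]
    _ = _ := by rw [lintegral_indicator hE]

/-- The set {D = 0} lies in m₀, and P({D = 0} ∩ E) is the integral of D over it. -/
theorem IsCondDensity.ae_ne_zero {D : Ω → ℝ≥0∞} (hD : IsCondDensity P m₀ E D) (hm : m₀ ≤ m)
    (hDm : Measurable[m₀] D) : ∀ᵐ ω ∂P, ω ∈ E → D ω ≠ 0 := by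
  have hA : MeasurableSet[m₀] (D ⁻¹' {0}) := hDm (measurableSet_singleton 0)
  have h0 : P (D ⁻¹' {0} ∩ E) = 0 := by
    rw [← hD _ hA, setLIntegral_congr_fun (hm _ hA) (g := fun _ => 0) (fun ω hω => hω)]
    simp
  filter_upwards [measure_eq_zero_iff_ae_notMem.mp h0] with ω hω hωE h
  exact hω ⟨h, hωE⟩

theorem isCondDensity_of_condExp [IsProbabilityMeasure P] (hm : m₀ ≤ m) (hE : MeasurableSet E)
    {D : Ω → ℝ} (hD : D =ᵐ[P] P[E.indicator (fun _ => (1 : ℝ)) | m₀]) :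
    IsCondDensity P m₀ E (fun ω => ENNReal.ofReal (D ω)) := by
  intro A hA
  have hint : Integrable (E.indicator (fun _ => (1 : ℝ))) P := (integrable_const 1).indicator hE
  have h0 : 0 ≤ᵐ[P] D := by
    have h : 0 ≤ᵐ[P] P[E.indicator (fun _ => (1 : ℝ)) | m₀] :=
      condExp_nonneg (Eventually.of_forall fun ω => indicator_nonneg (by simp) ω)
    filter_upwards [h, hD] with ω h1 h2
    rwa [h2]
  rw [← ofReal_integral_eq_lintegral_ofReal
      ((integrable_condExp (m := m₀)).congr hD.symm).integrableOn (ae_restrict_of_ae h0),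
    setIntegral_congr_ae (hm A hA) (hD.mono fun ω h _ => h), setIntegral_condExp hm hint hA,
    setIntegral_indicator hE]
  simp

theorem IsCondDensity.integrable_mul {D : Ω → ℝ}
    (hD : IsCondDensity P m₀ E (fun ω => ENNReal.ofReal (D ω))) (hm : m₀ ≤ m)
    (hE : MeasurableSet E) (hDm : AEStronglyMeasurable D P) (hD0 : 0 ≤ᵐ[P] D) {φ : Ω → ℝ}
    (hφ : StronglyMeasurable[m₀] φ) (hint : Integrable (E.indicator φ) P) :
    Integrable (fun ω => φ ω * D ω) P := by
  refine ⟨(hφ.mono hm).aestronglyMeasurable.mul hDm, ?_⟩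
  have h := hint.2
  rw [hasFiniteIntegral_iff_enorm] at h ⊢
  have h1 : ∫⁻ ω, ‖φ ω * D ω‖ₑ ∂P = ∫⁻ ω, ‖φ ω‖ₑ * ENNReal.ofReal (D ω) ∂P := by
    refine lintegral_congr_ae ?_
    filter_upwards [hD0] with ω hω
    rw [enorm_mul, Real.enorm_of_nonneg hω]
  rw [h1, hD.lintegral_mul hm hE hDm.aemeasurable.ennreal_ofReal (f := fun ω => ‖φ ω‖ₑ)
    (measurable_enorm.comp hφ.measurable)]
  simpa only [enorm_indicator_eq_indicator_enorm] using h

theorem IsCondDensity.integral_mul {D : Ω → ℝ}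
    (hD : IsCondDensity P m₀ E (fun ω => ENNReal.ofReal (D ω))) (hm : m₀ ≤ m)
    (hE : MeasurableSet E) (hDm : AEStronglyMeasurable D P) (hD0 : 0 ≤ᵐ[P] D) {φ : Ω → ℝ}
    (hφ : StronglyMeasurable[m₀] φ) (hint : Integrable (E.indicator φ) P) :
    ∫ ω, φ ω * D ω ∂P = ∫ ω, E.indicator φ ω ∂P := by
  have key : ∀ ψ : Ω → ℝ, StronglyMeasurable[m₀] ψ →
      ∫⁻ ω, ENNReal.ofReal (ψ ω * D ω) ∂P = ∫⁻ ω, ENNReal.ofReal (E.indicator ψ ω) ∂P := by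
    intro ψ hψ
    have h1 : ∫⁻ ω, ENNReal.ofReal (ψ ω * D ω) ∂P
        = ∫⁻ ω, ENNReal.ofReal (ψ ω) * ENNReal.ofReal (D ω) ∂P := by
      refine lintegral_congr_ae ?_
      filter_upwards [hD0] with ω hω
      rw [ENNReal.ofReal_mul' hω]
    rw [h1, hD.lintegral_mul hm hE hDm.aemeasurable.ennreal_ofReal hψ.measurable.ennreal_ofReal]
    refine lintegral_congr fun ω => ?_
    by_cases h : ω ∈ E <;> simp [h]
  rw [integral_eq_lintegral_pos_part_sub_lintegral_neg_part
      (hD.integrable_mul hm hE hDm hD0 hφ hint),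
    integral_eq_lintegral_pos_part_sub_lintegral_neg_part hint, key φ hφ]
  have := key (fun ω => -φ ω) hφ.neg
  simp only [neg_mul] at this
  rw [this]
  congr 2
  refine lintegral_congr fun ω => ?_
  by_cases h : ω ∈ E <;> simp [h]

theorem IsCondDensity.condExp_mul [IsProbabilityMeasure P] {D : Ω → ℝ}
    (hD : IsCondDensity P m₀ E (fun ω => ENNReal.ofReal (D ω))) (hm : m₀ ≤ m) (hm₁ : m₁ ≤ m₀)
    (hE : MeasurableSet E) (hDm : AEStronglyMeasurable D P) (hD0 : 0 ≤ᵐ[P] D) {φ : Ω → ℝ}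
    (hφ : StronglyMeasurable[m₀] φ) (hint : Integrable (E.indicator φ) P) :
    P[fun ω => φ ω * D ω | m₁] =ᵐ[P] P[E.indicator φ | m₁] := by
  refine ae_eq_condExp_of_forall_setIntegral_eq (hm₁.trans hm) hint
    (fun s _ _ => integrable_condExp.integrableOn) (fun A hA _ => ?_)
    stronglyMeasurable_condExp.aestronglyMeasurable
  have hAm := (hm₁.trans hm) A hA
  rw [setIntegral_condExp (hm₁.trans hm) (hD.integrable_mul hm hE hDm hD0 hφ hint) hA,
    ← integral_indicator hAm, ← integral_indicator hAm]
  have hc : A.indicator (E.indicator φ) = E.indicator (A.indicator φ) := by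
    rw [indicator_indicator, indicator_indicator, inter_comm]
  have h2 : Integrable (E.indicator (A.indicator φ)) P := hc ▸ hint.indicator hAm
  rw [hc, ← hD.integral_mul hm hE hDm hD0 (hφ.indicator (hm₁ A hA)) h2]
  refine integral_congr_ae (Eventually.of_forall fun ω => ?_)
  by_cases h : ω ∈ A <;> simp [h]

/-- Conditional expectations with respect to a σ-algebra `m₁ ⊇ m₀` which has the same trace as
`m₀` on the event `E`. -/
theorem IsCondDensity.condExp_eq_div [IsProbabilityMeasure P] {D : Ω → ℝ}
    (hD : IsCondDensity P m₀ E (fun ω => ENNReal.ofReal (D ω))) (hm : m₁ ≤ m) (hm₀ : m₀ ≤ m₁)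
    (hE : MeasurableSet[m₁] E)
    (htrace : ∀ A, MeasurableSet[m₁] A → ∃ B, MeasurableSet[m₀] B ∧ A ∩ E = B ∩ E)
    (hDm : StronglyMeasurable[m₀] D) (hD0 : 0 ≤ᵐ[P] D) {X : Ω → ℝ} (hX : Integrable X P)
    (hXE : ∀ ω, ω ∉ E → X ω = 0) :
    P[X | m₁] =ᵐ[P] E.indicator (fun ω => (P[X | m₀]) ω / D ω) := by
  have hm' := hm₀.trans hm
  have hEm := hm E hE
  have hpos : ∀ᵐ ω ∂P, ω ∈ E → D ω ≠ 0 := by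
    filter_upwards [hD.ae_ne_zero hm' hDm.measurable.ennreal_ofReal] with ω h hω h0
    exact h hω (by simp [h0])
  have hDs : MeasurableSet[m₀] {ω | D ω ≠ 0} :=
    hDm.measurable (measurableSet_singleton (0 : ℝ)).compl
  set N := P[X | m₀] with hN
  have hNm : StronglyMeasurable[m₀] N := stronglyMeasurable_condExp
  have hNi : Integrable N P := integrable_condExp
  have hqm : StronglyMeasurable[m₀] (fun ω => N ω / D ω) :=
    (hNm.measurable.div hDm.measurable).stronglyMeasurable
  -- Under the density, the integral of |N/D| over E is that of |N/D|·D, which is at most that of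
  -- |N|.
  have hqi : Integrable (E.indicator (fun ω => N ω / D ω)) P := by
    refine ⟨((hqm.mono hm').indicator hEm).aestronglyMeasurable, ?_⟩
    rw [hasFiniteIntegral_iff_enorm]
    simp only [enorm_indicator_eq_indicator_enorm]
    rw [← hD.lintegral_mul hm' hEm (hDm.mono hm').measurable.ennreal_ofReal.aemeasurable
      (f := fun ω => ‖N ω / D ω‖ₑ) (measurable_enorm.comp hqm.measurable)]
    refine lt_of_le_of_lt (lintegral_mono_ae ?_) hNi.2
    filter_upwards [hD0] with ω hω
    rw [← Real.enorm_of_nonneg hω, ← enorm_mul]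
    by_cases h : D ω = 0
    · simp [h]
    · rw [div_mul_cancel₀ _ h]
  symm
  refine ae_eq_condExp_of_forall_setIntegral_eq hm hX (fun s _ _ => hqi.integrableOn)
    (fun A hA _ => ?_) ((hqm.mono hm₀).indicator hE).aestronglyMeasurable
  obtain ⟨B, hB, hAB⟩ := htrace A hA
  have hBm := hm' B hB
  -- A function vanishing off E sees only the trace of A on E, so A may be exchanged for a set of
  -- m₀.
  have hswap : ∀ f : Ω → ℝ, (∀ ω, ω ∉ E → f ω = 0) → ∫ ω in A, f ω ∂P = ∫ ω in B, f ω ∂P := by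
    intro f hf
    have hfE : f = E.indicator f := by
      ext ω
      by_cases h : ω ∈ E <;> simp [h, hf]
    rw [hfE, setIntegral_indicator hEm, setIntegral_indicator hEm, hAB]
  have hBE : E.indicator (B.indicator fun ω => N ω / D ω)
      = B.indicator (E.indicator fun ω => N ω / D ω) := by
    rw [indicator_indicator, indicator_indicator, inter_comm]
  rw [hswap _ (fun ω h => by simp [h]), hswap X hXE]
  calc ∫ ω in B, E.indicator (fun ω => N ω / D ω) ω ∂P
      = ∫ ω, E.indicator (B.indicator fun ω => N ω / D ω) ω ∂P := by
        rw [← integral_indicator hBm, hBE]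
    _ = ∫ ω, B.indicator (fun ω => N ω / D ω) ω * D ω ∂P := by
        rw [hD.integral_mul hm' hEm (hDm.mono hm').aestronglyMeasurable hD0 (hqm.indicator hB)]
        rw [hBE]
        exact hqi.indicator hBm
    -- Division by zero returns 0, so (N/D)·D is N only where D ≠ 0. That set is in m₀, which allows
    -- N to be replaced by X; afterwards it can be dropped, since D ≠ 0 a.s. on E and X = 0 off E.
    _ = ∫ ω in B ∩ {ω | D ω ≠ 0}, N ω ∂P := by
        rw [← integral_indicator (hm' _ (hB.inter hDs))]
        refine integral_congr_ae (Eventually.of_forall fun ω => ?_)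
        by_cases h : ω ∈ B <;> by_cases h' : D ω = 0 <;> simp [h, h']
    _ = ∫ ω in B ∩ {ω | D ω ≠ 0}, X ω ∂P := setIntegral_condExp hm' hX (hB.inter hDs)
    _ = ∫ ω in B, X ω ∂P := by
        rw [← integral_indicator hBm, ← integral_indicator (hm' _ (hB.inter hDs))]
        refine integral_congr_ae ?_
        filter_upwards [hpos] with ω hω
        by_cases h : ω ∈ B <;> by_cases h' : D ω = 0 <;> simp [h, h']
        exact (hXE ω fun hE => hω hE h').symm

theorem IsCondDensity.condLExp_eq_div [IsProbabilityMeasure P]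
    {D : Ω → ℝ≥0∞} (hD : IsCondDensity P m₀ E D) (hm : m₁ ≤ m) (hm₀ : m₀ ≤ m₁)
    (hE : MeasurableSet[m₁] E)
    (htrace : ∀ A, MeasurableSet[m₁] A → ∃ B, MeasurableSet[m₀] B ∧ A ∩ E = B ∩ E)
    (hDm : Measurable[m₀] D) {X : Ω → ℝ≥0∞} (hXE : ∀ ω, ω ∉ E → X ω = 0) :
    condLExp m₁ P X =ᵐ[P] E.indicator (fun ω => condLExp m₀ P X ω / D ω) := by
  have hm' := hm₀.trans hm
  have hEm := hm E hE
  have hpos := hD.ae_ne_zero hm' hDm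
  have hDs : MeasurableSet[m₀] {ω | D ω ≠ 0} := hDm (measurableSet_singleton 0).compl
  -- In `ℝ≥0∞` cancelling D requires D finite as well as nonzero.
  have htop : ∀ᵐ ω ∂P, D ω ≠ ∞ := by
    refine (ae_lt_top (hDm.mono hm' le_rfl) ?_).mono fun _ h => h.ne
    rw [← setLIntegral_univ, hD _ MeasurableSet.univ]
    exact measure_ne_top _ _
  set N := condLExp m₀ P X with hN
  have hNm : Measurable[m₀] N := measurable_condLExp _ _ _
  have hqm : Measurable[m₀] (fun ω => N ω / D ω) := hNm.div hDm
  symm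
  refine ae_eq_condLExp hm P X ((hqm.mono hm₀ le_rfl).indicator hE) fun A hA => ?_
  obtain ⟨B, hB, hAB⟩ := htrace A hA
  have hBm := hm' B hB
  have hswap : ∀ f : Ω → ℝ≥0∞, (∀ ω, ω ∉ E → f ω = 0) →
      ∫⁻ ω in A, f ω ∂P = ∫⁻ ω in B, f ω ∂P := by
    intro f hf
    have hfE : f = E.indicator f := by
      ext ω
      by_cases h : ω ∈ E <;> simp [h, hf]
    rw [hfE, setLIntegral_indicator hEm, setLIntegral_indicator hEm, inter_comm, hAB, inter_comm]
  rw [hswap _ (fun ω h => by simp [h]), hswap X hXE]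
  calc ∫⁻ ω in B, E.indicator (fun ω => N ω / D ω) ω ∂P
      = ∫⁻ ω, E.indicator (B.indicator fun ω => N ω / D ω) ω ∂P := by
        rw [← lintegral_indicator hBm, indicator_indicator, indicator_indicator, inter_comm]
    _ = ∫⁻ ω, B.indicator (fun ω => N ω / D ω) ω * D ω ∂P := by
        rw [hD.lintegral_mul hm' hEm (hDm.mono hm' le_rfl).aemeasurable (hqm.indicator hB)]
    _ = ∫⁻ ω in B ∩ {ω | D ω ≠ 0}, N ω ∂P := by
        rw [← lintegral_indicator (hm' _ (hB.inter hDs))]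
        refine lintegral_congr_ae ?_
        filter_upwards [htop] with ω ht
        by_cases h : ω ∈ B <;> by_cases h' : D ω = 0 <;> simp [h, h']
        exact ENNReal.div_mul_cancel h' ht
    _ = ∫⁻ ω in B ∩ {ω | D ω ≠ 0}, X ω ∂P := setLIntegral_condLExp hm' P X (hB.inter hDs)
    _ = ∫⁻ ω in B, X ω ∂P := by
        rw [← lintegral_indicator hBm, ← lintegral_indicator (hm' _ (hB.inter hDs))]
        refine lintegral_congr_ae ?_
        filter_upwards [hpos] with ω hω
        by_cases h : ω ∈ B <;> by_cases h' : D ω = 0 <;> simp [h, h']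
        exact (hXE ω fun hE => hω hE h').symm

end Density

/-! ### The filtration of the delay-informed investor -/

section Investor

variable {Ω : Type*} {m : MeasurableSpace Ω} {𝓕 : Filtration ℝ≥0 m} {τ : Ω → ℝ≥0}
  {hτ : Measurable τ} {δ : ℝ≥0 → ℝ≥0} {hδ : Monotone fun t => t - δ t}

theorem defaultFiltration_apply (t : ℝ≥0) :
    defaultFiltration τ hτ t = ⨅ s > t, rawDefaultFiltration τ hτ s :=
  Filtration.rightCont_eq _ _

theorem measurableSet_defaultFiltration_iff {t : ℝ≥0} {A : Set Ω} :
    MeasurableSet[defaultFiltration τ hτ t] A ↔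
      ∀ s > t, MeasurableSet[rawDefaultFiltration τ hτ s] A := by
  rw [defaultFiltration_apply]
  simp only [MeasurableSpace.measurableSet_iInf]

theorem measurableSet_lt_defaultFiltration (t : ℝ≥0) :
    MeasurableSet[defaultFiltration τ hτ t] {ω | t < τ ω} := by
  refine measurableSet_defaultFiltration_iff.mpr fun s hs => ⟨Ioi t, measurableSet_Ioi, ?_⟩
  ext ω
  simpa using fun _ => hs

/-- Two outcomes surviving past t are not separated by 𝓓_t: with s the smaller of their default
times, s > t and τ ∧ s takes the value s at both. -/
theorem subset_or_disjoint_of_measurableSet_defaultFiltration {t : ℝ≥0} {A : Set Ω}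
    (hA : MeasurableSet[defaultFiltration τ hτ t] A) :
    A ∩ {ω | t < τ ω} = ∅ ∨ A ∩ {ω | t < τ ω} = {ω | t < τ ω} := by
  by_contra! h
  obtain ⟨⟨ω₁, h₁, ht₁⟩, h₂⟩ := h
  obtain ⟨ω₂, ht₂, h₂⟩ : ∃ ω₂, t < τ ω₂ ∧ ω₂ ∉ A := by
    by_contra! h
    exact h₂ (inter_eq_right.mpr h)
  obtain ⟨U, -, rfl⟩ := measurableSet_defaultFiltration_iff.mp hA (min (τ ω₁) (τ ω₂))
    (lt_min ht₁ ht₂)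
  apply h₂
  simpa using h₁

theorem delayedFiltration_le_investorFiltration (t : ℝ≥0) :
    delayedFiltration 𝓕 δ hδ t ≤ investorFiltration 𝓕 δ hδ τ hτ t :=
  (le_sup_left : delayedFiltration 𝓕 δ hδ ≤ investorFiltration 𝓕 δ hδ τ hτ) t

theorem measurableSet_lt_investorFiltration (t : ℝ≥0) :
    MeasurableSet[investorFiltration 𝓕 δ hδ τ hτ t] {ω | t < τ ω} :=
  (le_sup_right : defaultFiltration τ hτ ≤ investorFiltration 𝓕 δ hδ τ hτ) t _
    (measurableSet_lt_defaultFiltration t)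

/-- Before default the investor only has the delayed information. -/
theorem exists_inter_eq_of_measurableSet_investorFiltration (t : ℝ≥0) (A : Set Ω)
    (hA : MeasurableSet[investorFiltration 𝓕 δ hδ τ hτ t] A) :
    ∃ B, MeasurableSet[delayedFiltration 𝓕 δ hδ t] B ∧
      A ∩ {ω | t < τ ω} = B ∩ {ω | t < τ ω} := by
  -- M consists of the sets whose trace on {τ > t} is the trace of an 𝓕ᴰ_t-set. Being a σ-algebra,
  -- it contains the supremum as soon as it contains both generators.
  let M : MeasurableSpace Ω := MeasurableSpace.map (Subtype.val : {ω | t < τ ω} → Ω)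
    (MeasurableSpace.comap Subtype.val (delayedFiltration 𝓕 δ hδ t))
  have hM : delayedFiltration 𝓕 δ hδ t ⊔ defaultFiltration τ hτ t ≤ M := by
    refine sup_le (fun B hB => ⟨B, hB, rfl⟩) fun B hB => ?_
    rcases subset_or_disjoint_of_measurableSet_defaultFiltration hB with h | h
    · refine ⟨∅, @MeasurableSet.empty _ (_), ?_⟩
      ext ⟨ω, hω⟩
      simpa using fun hB => (h.subset ⟨hB, hω⟩ : ω ∈ (∅ : Set Ω))
    · refine ⟨univ, @MeasurableSet.univ _ (_), ?_⟩
      ext ⟨ω, hω⟩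
      simpa using (h.superset hω).1
  obtain ⟨B, hB, h⟩ := hM A hA
  refine ⟨B, hB, ?_⟩
  ext ω
  refine and_congr_left fun hω => ?_
  exact (Set.ext_iff.mp h ⟨ω, hω⟩).symm

theorem delayedFiltration_le (t : ℝ≥0) : delayedFiltration 𝓕 δ hδ t ≤ 𝓕 t :=
  𝓕.mono tsub_le_self

end Investor

/-! ### Conditional expectations before default -/

namespace IsAzemaSupermartingale

variable {Ω : Type*} {m : MeasurableSpace Ω} {P : Measure Ω}
  {𝓕 : Filtration ℝ≥0 m} {τ : Ω → ℝ≥0} {S : ℝ≥0 → Ω → ℝ}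
  {δ : ℝ≥0 → ℝ≥0} {hδ : Monotone fun t => t - δ t}

theorem ae_nonneg (hS : IsAzemaSupermartingale P 𝓕 τ S) (t : ℝ≥0) : 0 ≤ᵐ[P] S t := by
  have h : 0 ≤ᵐ[P] P[{ω | t < τ ω}.indicator (fun _ => (1 : ℝ)) | 𝓕 t] :=
    condExp_nonneg (Eventually.of_forall fun ω => indicator_nonneg (by simp) ω)
  filter_upwards [h, hS.condExp t] with ω h1 h2
  rwa [h2]

theorem aestronglyMeasurable (hS : IsAzemaSupermartingale P 𝓕 τ S) (t : ℝ≥0) :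
    AEStronglyMeasurable (S t) P :=
  ((hS.adapted t).mono (𝓕.le t)).aestronglyMeasurable

theorem integrable (hS : IsAzemaSupermartingale P 𝓕 τ S) (t : ℝ≥0) : Integrable (S t) P :=
  integrable_condExp.congr (hS.condExp t).symm

theorem condExp_delayedFiltration_nonneg (hS : IsAzemaSupermartingale P 𝓕 τ S) (t : ℝ≥0) :
    0 ≤ᵐ[P] P[S t | delayedFiltration 𝓕 δ hδ t] :=
  condExp_nonneg (hS.ae_nonneg t)

variable [IsProbabilityMeasure P]

theorem isCondDensity (hS : IsAzemaSupermartingale P 𝓕 τ S) (hτ : Measurable τ) (t : ℝ≥0) :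
    IsCondDensity P (𝓕 t) {ω | t < τ ω} (fun ω => ENNReal.ofReal (S t ω)) :=
  isCondDensity_of_condExp (𝓕.le t) (measurableSet_lt measurable_const hτ) (hS.condExp t)

theorem ae_le_one (hS : IsAzemaSupermartingale P 𝓕 τ S) (hτ : Measurable τ) (t : ℝ≥0) :
    ∀ᵐ ω ∂P, S t ω ≤ 1 := by
  have h : P[{ω | t < τ ω}.indicator (fun _ => (1 : ℝ)) | 𝓕 t] ≤ᵐ[P] P[fun _ => (1 : ℝ) | 𝓕 t] :=
    condExp_mono ((integrable_const 1).indicator (measurableSet_lt measurable_const hτ))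
      (integrable_const 1)
      (Eventually.of_forall fun ω => indicator_le_self' (fun _ _ => zero_le_one) ω)
  rw [condExp_const (𝓕.le t)] at h
  filter_upwards [h, hS.condExp t] with ω h1 h2
  rwa [h2]

theorem condExp_delayedFiltration (hS : IsAzemaSupermartingale P 𝓕 τ S) (t : ℝ≥0) :
    P[S t | delayedFiltration 𝓕 δ hδ t]
      =ᵐ[P] P[{ω | t < τ ω}.indicator (fun _ => (1 : ℝ)) | delayedFiltration 𝓕 δ hδ t] :=
  (condExp_congr_ae (hS.condExp t)).trans
    (condExp_condExp_of_le (delayedFiltration_le t) (𝓕.le t))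

theorem isCondDensity_delayed (hS : IsAzemaSupermartingale P 𝓕 τ S) (hτ : Measurable τ) (t : ℝ≥0) :
    IsCondDensity P (delayedFiltration 𝓕 δ hδ t) {ω | t < τ ω}
      (fun ω => ENNReal.ofReal ((P[S t | delayedFiltration 𝓕 δ hδ t]) ω)) :=
  isCondDensity_of_condExp (Filtration.le _ t) (measurableSet_lt measurable_const hτ)
    (hS.condExp_delayedFiltration t)

theorem condExp_delayedFiltration_pos (hS : IsAzemaSupermartingale P 𝓕 τ S) (hτ : Measurable τ)
    (t : ℝ≥0) : ∀ᵐ ω ∂P, t < τ ω → 0 < (P[S t | delayedFiltration 𝓕 δ hδ t]) ω := by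
  filter_upwards [(hS.isCondDensity_delayed hτ t).ae_ne_zero (Filtration.le _ t)
    (stronglyMeasurable_condExp.measurable.ennreal_ofReal)] with ω h hω
  simpa using h hω

/-- The conditional expectation, given the information of the investor, of a random variable which
vanishes after default. -/
theorem condExp_investorFiltration (hS : IsAzemaSupermartingale P 𝓕 τ S) (hτ : Measurable τ)
    (t : ℝ≥0) {X : Ω → ℝ} (hX : Integrable X P) (hX0 : ∀ ω, ¬ t < τ ω → X ω = 0) :
    P[X | investorFiltration 𝓕 δ hδ τ hτ t] =ᵐ[P] {ω | t < τ ω}.indicator (fun ω =>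
      (P[X | delayedFiltration 𝓕 δ hδ t]) ω / (P[S t | delayedFiltration 𝓕 δ hδ t]) ω) :=
  (hS.isCondDensity_delayed hτ t).condExp_eq_div (Filtration.le _ t)
    (delayedFiltration_le_investorFiltration t) (measurableSet_lt_investorFiltration t)
    (exists_inter_eq_of_measurableSet_investorFiltration t) stronglyMeasurable_condExp
    (hS.condExp_delayedFiltration_nonneg t) hX hX0

theorem integrable_mul (hS : IsAzemaSupermartingale P 𝓕 τ S) (hτ : Measurable τ) {θ : ℝ≥0}
    {φ : Ω → ℝ} (hφ : StronglyMeasurable[𝓕 θ] φ)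
    (hint : Integrable ({ω | θ < τ ω}.indicator φ) P) :
    Integrable (fun ω => φ ω * S θ ω) P :=
  (hS.isCondDensity hτ θ).integrable_mul (𝓕.le θ) (measurableSet_lt measurable_const hτ)
    (hS.aestronglyMeasurable θ) (hS.ae_nonneg θ) hφ hint

theorem setIntegral_mul (hS : IsAzemaSupermartingale P 𝓕 τ S) (hτ : Measurable τ) {θ : ℝ≥0}
    {φ : Ω → ℝ} (hφ : StronglyMeasurable[𝓕 θ] φ)
    (hint : Integrable ({ω | θ < τ ω}.indicator φ) P) {A : Set Ω} (hA : MeasurableSet[𝓕 θ] A) :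
    ∫ ω in A, φ ω * S θ ω ∂P = ∫ ω in A, {ω | θ < τ ω}.indicator φ ω ∂P := by
  have h := (hS.isCondDensity hτ θ).condExp_mul (𝓕.le θ) le_rfl
    (measurableSet_lt measurable_const hτ) (hS.aestronglyMeasurable θ) (hS.ae_nonneg θ) hφ hint
  rw [← setIntegral_condExp (𝓕.le θ) (hS.integrable_mul hτ hφ hint) hA,
    ← setIntegral_condExp (𝓕.le θ) hint hA]
  exact setIntegral_congr_ae (𝓕.le θ A hA) (h.mono fun _ h _ => h)

theorem condExp_mul_delayedFiltration (hS : IsAzemaSupermartingale P 𝓕 τ S) (hτ : Measurable τ)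
    {t θ : ℝ≥0} (htθ : t ≤ θ) {φ : Ω → ℝ} (hφ : StronglyMeasurable[𝓕 θ] φ)
    (hint : Integrable ({ω | θ < τ ω}.indicator φ) P) :
    P[fun ω => φ ω * S θ ω | delayedFiltration 𝓕 δ hδ t]
      =ᵐ[P] P[{ω | θ < τ ω}.indicator φ | delayedFiltration 𝓕 δ hδ t] :=
  (hS.isCondDensity hτ θ).condExp_mul (𝓕.le θ) ((delayedFiltration_le t).trans (𝓕.mono htθ))
    (measurableSet_lt measurable_const hτ) (hS.aestronglyMeasurable θ) (hS.ae_nonneg θ) hφ hint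

theorem condExp_indicator_investorFiltration (hS : IsAzemaSupermartingale P 𝓕 τ S)
    (hτ : Measurable τ) {t θ : ℝ≥0} (htθ : t ≤ θ) {φ : Ω → ℝ} (hφ : StronglyMeasurable[𝓕 θ] φ)
    (hint : Integrable ({ω | θ < τ ω}.indicator φ) P) :
    P[{ω | θ < τ ω}.indicator φ | investorFiltration 𝓕 δ hδ τ hτ t] =ᵐ[P]
      {ω | t < τ ω}.indicator (fun ω =>
        (P[fun ω' => φ ω' * S θ ω' | delayedFiltration 𝓕 δ hδ t]) ω /
          (P[S t | delayedFiltration 𝓕 δ hδ t]) ω) := by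
  refine (hS.condExp_investorFiltration hτ t hint fun ω h => ?_).trans ?_
  · exact indicator_of_notMem (s := {ω | θ < τ ω}) (fun h' => h (htθ.trans_lt h')) _
  · filter_upwards [hS.condExp_mul_delayedFiltration (δ := δ) (hδ := hδ) hτ htθ hφ hint] with ω h
    simp only [indicator, h]

theorem condLExp_indicator_investorFiltration (hS : IsAzemaSupermartingale P 𝓕 τ S)
    (hτ : Measurable τ) {t θ : ℝ≥0} (htθ : t ≤ θ) {φ : Ω → ℝ≥0∞} (hφ : Measurable[𝓕 θ] φ) :
    condLExp (investorFiltration 𝓕 δ hδ τ hτ t) P ({ω | θ < τ ω}.indicator φ) =ᵐ[P]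
      {ω | t < τ ω}.indicator (fun ω =>
        condLExp (delayedFiltration 𝓕 δ hδ t) P (fun ω' => φ ω' * ENNReal.ofReal (S θ ω')) ω /
          condLExp (delayedFiltration 𝓕 δ hδ t) P (fun ω' => ENNReal.ofReal (S t ω')) ω) := by
  have hle : delayedFiltration 𝓕 δ hδ t ≤ 𝓕 t := delayedFiltration_le t
  have hD : IsCondDensity P (delayedFiltration 𝓕 δ hδ t) {ω | t < τ ω}
      (condLExp (delayedFiltration 𝓕 δ hδ t) P fun ω' => ENNReal.ofReal (S t ω')) := by
    intro A hA
    rw [setLIntegral_condLExp (Filtration.le _ t) P _ hA]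
    exact hS.isCondDensity hτ t A (hle A hA)
  have hN : condLExp (delayedFiltration 𝓕 δ hδ t) P (fun ω' => φ ω' * ENNReal.ofReal (S θ ω'))
      =ᵐ[P] condLExp (delayedFiltration 𝓕 δ hδ t) P ({ω | θ < τ ω}.indicator φ) := by
    refine ae_eq_condLExp (Filtration.le _ t) P _ (measurable_condLExp _ _ _) fun A hA => ?_
    have hAm := Filtration.le _ t A hA
    rw [setLIntegral_condLExp (Filtration.le _ t) P _ hA, ← lintegral_indicator hAm,
      ← lintegral_indicator hAm, indicator_indicator, inter_comm, ← indicator_indicator,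
      ← (hS.isCondDensity hτ θ).lintegral_mul (𝓕.le θ) (measurableSet_lt measurable_const hτ)
        (hS.aestronglyMeasurable θ).aemeasurable.ennreal_ofReal
        (hφ.indicator (𝓕.mono htθ _ (hle A hA)))]
    refine lintegral_congr fun ω => ?_
    by_cases h : ω ∈ A <;> simp [h]
  refine (hD.condLExp_eq_div (Filtration.le _ t)
    (delayedFiltration_le_investorFiltration t) (measurableSet_lt_investorFiltration t)
    (exists_inter_eq_of_measurableSet_investorFiltration t) (measurable_condLExp _ _ _)
    fun ω h => ?_).trans ?_
  · exact indicator_of_notMem (s := {ω | θ < τ ω}) (fun h' => h (htθ.trans_lt h')) _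
  · filter_upwards [hN] with ω h
    simp only [indicator, h]

end IsAzemaSupermartingale

/-! ### Stochastic integrals against the Azéma supermartingale -/

section StochasticIntegral

variable {Ω : Type*} {m : MeasurableSpace Ω} {P : Measure Ω} [IsProbabilityMeasure P]
  {𝓕 : Filtration ℝ≥0 m} {τ : Ω → ℝ≥0} {S : ℝ≥0 → Ω → ℝ} {a b : ℝ≥0}

/-- The integral of `K` against `S` is, up to a martingale, minus the payment `K_τ` at default. -/
theorem HasBddStochIntegral.integrable_and_setIntegral_eq (hS : IsAzemaSupermartingale P 𝓕 τ S)
    (hτ : Measurable τ) {K : ℝ≥0 → Ω → ℝ} {I : Ω → ℝ} (h : HasBddStochIntegral P 𝓕 S a b K I) :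
    Integrable I P ∧ Integrable ({ω | a < τ ω ∧ τ ω ≤ b}.indicator fun ω => K (τ ω) ω) P ∧
      ∀ A, MeasurableSet[𝓕 a] A → ∫ ω in A, I ω ∂P =
        - ∫ ω in A, {ω | a < τ ω ∧ τ ω ≤ b}.indicator (fun ω => K (τ ω) ω) ω ∂P := by
  induction h with
  | step s v has hsv hvb ξ hξ c hc =>
    have hξm := (hξ.mono (𝓕.le s)).aestronglyMeasurable (μ := P)
    have hbdd : ∀ E : Set Ω, MeasurableSet E → Integrable (E.indicator ξ) P := fun E hE =>
      (Integrable.of_bound hξm c (Eventually.of_forall hc)).indicator hE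
    have hlt : ∀ u, MeasurableSet {ω | u < τ ω} := fun u => measurableSet_lt measurable_const hτ
    have hi : ∀ u, s ≤ u → Integrable (fun ω => ξ ω * S u ω) P := fun u hu =>
      hS.integrable_mul hτ (hξ.mono (𝓕.mono hu)) (hbdd _ (hlt u))
    have hset : ∀ u, s ≤ u → ∀ A, MeasurableSet[𝓕 a] A →
        ∫ ω in A, ξ ω * S u ω ∂P = ∫ ω in A, {ω | u < τ ω}.indicator ξ ω ∂P := by
      intro u hu A hA
      exact hS.setIntegral_mul hτ (hξ.mono (𝓕.mono hu)) (hbdd _ (hlt u))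
        (𝓕.mono (has.trans hu) A hA)
    -- The payment at default is ξ 1_{s < τ ≤ v} = ξ 1_{τ > s} - ξ 1_{τ > v}, whereas the integral
    -- is ξ S_v - ξ S_s; this reversal is the source of the minus sign.
    have hK : ({ω | a < τ ω ∧ τ ω ≤ b}.indicator fun ω => (Ioc s v).indicator (fun _ => ξ ω) (τ ω))
        = fun ω => {ω | s < τ ω}.indicator ξ ω - {ω | v < τ ω}.indicator ξ ω := by
      ext ω
      simp only [indicator, mem_ofPred_eq, mem_Ioc]
      grind
    rw [hK]
    refine ⟨?_, (hbdd _ (hlt s)).sub (hbdd _ (hlt v)), fun A hA => ?_⟩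
    · simp only [mul_sub]
      exact (hi v hsv).sub (hi s le_rfl)
    · simp only [mul_sub]
      rw [integral_sub (hi v hsv).integrableOn (hi s le_rfl).integrableOn,
        integral_sub (hbdd _ (hlt s)).integrableOn (hbdd _ (hlt v)).integrableOn,
        hset v hsv A hA, hset s le_rfl A hA, neg_sub]
  | add K K' I I' h h' ih ih' =>
    have hadd : ({ω | a < τ ω ∧ τ ω ≤ b}.indicator fun ω => K (τ ω) ω + K' (τ ω) ω)
        = fun ω => {ω | a < τ ω ∧ τ ω ≤ b}.indicator (fun ω => K (τ ω) ω) ω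
          + {ω | a < τ ω ∧ τ ω ≤ b}.indicator (fun ω => K' (τ ω) ω) ω := by
      ext ω
      by_cases h : a < τ ω ∧ τ ω ≤ b <;> simp [h]
    rw [hadd]
    refine ⟨ih.1.add ih'.1, ih.2.1.add ih'.2.1, fun A hA => ?_⟩
    rw [integral_add ih.1.integrableOn ih'.1.integrableOn,
      integral_add ih.2.1.integrableOn ih'.2.1.integrableOn, ih.2.2 A hA, ih'.2.2 A hA, neg_add]
  | lim Kn In K I c h hbound hKlim hI hIlim ih =>
    have hlim : ∀ ω, Tendsto
        (fun n => {ω | a < τ ω ∧ τ ω ≤ b}.indicator (fun ω => Kn n (τ ω) ω) ω) atTop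
        (𝓝 ({ω | a < τ ω ∧ τ ω ≤ b}.indicator (fun ω => K (τ ω) ω) ω)) := by
      intro ω
      by_cases h : a < τ ω ∧ τ ω ≤ b
      · simpa [h] using hKlim (τ ω) h ω
      · simp [h]
    -- The bound is |c|: if (a,b] is empty nothing forces c ≥ 0, yet the indicator still takes the
    -- value 0.
    have hb : ∀ n ω, ‖{ω | a < τ ω ∧ τ ω ≤ b}.indicator (fun ω => Kn n (τ ω) ω) ω‖ ≤ |c| := by
      intro n ω
      by_cases h : a < τ ω ∧ τ ω ≤ b
      · simpa [h] using (hbound n (τ ω) h ω).trans (le_abs_self c)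
      · simp [h]
    have hm : AEStronglyMeasurable ({ω | a < τ ω ∧ τ ω ≤ b}.indicator fun ω => K (τ ω) ω) P :=
      aestronglyMeasurable_of_tendsto_ae atTop (fun n => (ih n).2.1.aestronglyMeasurable)
        (Eventually.of_forall hlim)
    refine ⟨hI, Integrable.of_bound hm |c| (Eventually.of_forall fun ω =>
      le_of_tendsto' (hlim ω).norm fun n => hb n ω), fun A hA => ?_⟩
    refine tendsto_nhds_unique (tendsto_setIntegral_of_L1' _ hI.aestronglyMeasurable
      (Eventually.of_forall fun n => (ih n).1) hIlim A) ?_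
    simp only [fun n => (ih n).2.2 A hA]
    exact (tendsto_integral_of_dominated_convergence (fun _ => |c|)
      (fun n => (ih n).2.1.aestronglyMeasurable.restrict) (integrable_const _)
      (fun n => Eventually.of_forall (hb n)) (Eventually.of_forall hlim)).neg

/-- Apply the bounded case to the truncations. The integrals converge in mean by assumption, and the
payments converge by domination by |H_τ| on {a < τ ≤ b}, assumed integrable. -/
theorem HasStochIntegral.setIntegral_eq (hS : IsAzemaSupermartingale P 𝓕 τ S)
    (hτ : Measurable τ) {H : ℝ≥0 → Ω → ℝ} {I : Ω → ℝ} (h : HasStochIntegral P 𝓕 S a b H I)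
    (hH : Integrable ({ω | a < τ ω ∧ τ ω ≤ b}.indicator fun ω => H (τ ω) ω) P)
    {A : Set Ω} (hA : MeasurableSet[𝓕 a] A) :
    ∫ ω in A, I ω ∂P =
      - ∫ ω in A, {ω | a < τ ω ∧ τ ω ≤ b}.indicator (fun ω => H (τ ω) ω) ω ∂P := by
  obtain ⟨hI, In, hIn, hlim⟩ := h
  have hIn' := hIn.mono fun n hn => hn.integrable_and_setIntegral_eq hS hτ
  have h1 := tendsto_setIntegral_of_L1' _ hI.aestronglyMeasurable
    (hIn'.mono fun n hn => hn.1) hlim A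
  have h2 : Tendsto (fun n : ℕ => ∫ ω in A, {ω | a < τ ω ∧ τ ω ≤ b}.indicator
      (fun ω => {x : ℝ | |x| ≤ n}.indicator id (H (τ ω) ω)) ω ∂P) atTop
      (𝓝 (∫ ω in A, {ω | a < τ ω ∧ τ ω ≤ b}.indicator (fun ω => H (τ ω) ω) ω ∂P)) := by
    refine tendsto_integral_filter_of_dominated_convergence _
      (hIn'.mono fun n hn => hn.2.1.aestronglyMeasurable.restrict)
      (Eventually.of_forall fun n => Eventually.of_forall fun ω => ?_) hH.norm.integrableOn
      (Eventually.of_forall fun ω => ?_)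
    · by_cases h : a < τ ω ∧ τ ω ≤ b <;> by_cases h' : |H (τ ω) ω| ≤ n <;> simp [h, h']
    · refine tendsto_const_nhds.congr' ?_
      filter_upwards [eventually_ge_atTop ⌈|H (τ ω) ω|⌉₊] with n hn
      have h' : |H (τ ω) ω| ≤ n := (Nat.le_ceil _).trans (by exact_mod_cast hn)
      by_cases h : a < τ ω ∧ τ ω ≤ b <;> simp [h, h']
  refine tendsto_nhds_unique h1 (h2.neg.congr' ?_)
  filter_upwards [hIn'] with n hn
  exact (hn.2.2 A hA).symm

end StochasticIntegral

/-! ### Measurability of the variation of an adapted continuous process -/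

section Variation

theorem tendsto_floor_mul_div_nnreal (x : ℝ≥0) :
    Tendsto (fun n : ℕ => (⌊n * x⌋₊ / n : ℝ≥0)) atTop (𝓝 x) := by
  rw [← NNReal.tendsto_coe]
  have h := (tendsto_nat_floor_mul_div_atTop x.coe_nonneg).comp
    (tendsto_natCast_atTop_atTop (R := ℝ))
  refine h.congr fun n => ?_
  simp only [Function.comp, NNReal.coe_div, NNReal.coe_natCast]
  rw [show ⌊(x : ℝ) * n⌋₊ = ⌊(n : ℝ≥0) * x⌋₊ by
    rw [mul_comm]
    exact Nonneg.nat_floor_coe ((n : ℝ≥0) * x)]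

/-- The variation of a continuous function is computed along the grids `{k / n}`. -/
theorem eVariationOn_Icc_zero_eq_iSup {f : ℝ≥0 → ℝ} (hf : Continuous f) (u : ℝ≥0) :
    eVariationOn f (Icc 0 u) =
      ⨆ n : ℕ, ∑ i ∈ Finset.range ⌊n * u⌋₊, edist (f (i / n)) (f ((i + 1 : ℕ) / n)) := by
  have hgrid : ∀ n : ℕ, Monotone fun k : ℕ => (k / n : ℝ≥0) := fun n k l hkl => by
    have : (k : ℝ≥0) ≤ l := by exact_mod_cast hkl
    dsimp only
    gcongr
  simp only [← fun n : ℕ => eVariationOn.image_range_of_monotone f (hgrid n)]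
  refine le_antisymm (le_of_forall_lt fun v hv => ?_) (iSup_le fun n => eVariationOn.mono _ ?_)
  -- Variation is lower semicontinuous under pointwise convergence. The step functions x ↦ f(⌊nx⌋/n)
  -- converge to f by continuity, and their variation is at most that of f on the grid.
  · have h := eVariationOn.lowerSemicontinuous_aux (p := atTop)
      (F := fun (n : ℕ) (x : ℝ≥0) => f (⌊n * x⌋₊ / n)) (fun x _ =>
        (hf.tendsto x).comp (tendsto_floor_mul_div_nnreal x)) hv
    obtain ⟨n, hn⟩ := h.exists
    refine hn.trans_le (le_trans ?_ (le_iSup _ n))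
    refine eVariationOn.comp_le_of_monotoneOn f (fun x : ℝ≥0 => (⌊n * x⌋₊ / n : ℝ≥0))
      (fun x _ y _ hxy => hgrid n (Nat.floor_mono (by gcongr))) fun x hx => ?_
    exact ⟨⌊n * x⌋₊, Nat.floor_mono (mul_le_mul_right hx.2 _), rfl⟩
  · rintro _ ⟨k, hk, rfl⟩
    refine ⟨zero_le, ?_⟩
    rcases Nat.eq_zero_or_pos n with rfl | hn
    · simp
    · have hn' : (0 : ℝ≥0) < n := by exact_mod_cast hn
      rw [div_le_iff₀ hn', mul_comm]
      exact (Nat.le_floor_iff zero_le).mp hk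

variable {Ω : Type*} {m : MeasurableSpace Ω} {𝓕 : Filtration ℝ≥0 m}

/-- Only grid times up to u enter the supremum. The σ-algebra is arbitrary so that it can be taken
to be 𝓕_u, which gives adaptedness of the variation. -/
theorem measurable_eVariationOn {Ω : Type*} {_ : MeasurableSpace Ω} {G : ℝ≥0 → Ω → ℝ} {u : ℝ≥0}
    (hG : ∀ v ≤ u, Measurable (G v)) (hGc : ∀ ω, Continuous fun u => G u ω) :
    Measurable fun ω => eVariationOn (fun v => G v ω) (Icc 0 u) := by
  simp only [fun ω => eVariationOn_Icc_zero_eq_iSup (hGc ω) u]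
  refine Measurable.iSup fun n => Finset.measurable_sum _ fun i hi => ?_
  have hle : ∀ k : ℕ, k ≤ ⌊n * u⌋₊ → (k / n : ℝ≥0) ≤ u := by
    intro k hk
    rcases Nat.eq_zero_or_pos n with rfl | hn
    · simp
    · have hn' : (0 : ℝ≥0) < n := by exact_mod_cast hn
      rw [div_le_iff₀ hn', mul_comm]
      exact (Nat.le_floor_iff zero_le).mp hk
  have hi' := Finset.mem_range.mp hi
  exact (hG _ (hle i hi'.le)).edist (hG _ (hle (i + 1) hi'))

theorem stronglyAdapted_variationOnFromTo {G : ℝ≥0 → Ω → ℝ} (hG : StronglyAdapted 𝓕 G)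
    (hGc : ∀ ω, Continuous fun u => G u ω) :
    StronglyAdapted 𝓕 fun u ω => variationOnFromTo (fun v => G v ω) univ 0 u := by
  intro u
  simp only [variationOnFromTo.eq_of_le _ _ (zero_le (a := u)), univ_inter]
  exact (ENNReal.measurable_toReal.comp (measurable_eVariationOn (fun v hv =>
    (hG v).measurable.mono (𝓕.mono hv) le_rfl) hGc)).stronglyMeasurable

end Variation

/-! ### Random Stieltjes measures -/

section Kernel

open ProbabilityTheory

variable {Ω : Type*} {m : MeasurableSpace Ω} {𝓕 : Filtration ℝ≥0 m}

/-- The parameter space is cut according to the integer part of the total mass; on the n-th piece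
the kernel is bounded by n + 1. -/
theorem isSFiniteKernel_of_isFiniteMeasure {α β : Type*} {_ : MeasurableSpace α}
    {_ : MeasurableSpace β} (κ : Kernel α β) (h : ∀ a, IsFiniteMeasure (κ a)) :
    IsSFiniteKernel κ := by
  classical
  have hs : ∀ n : ℕ, MeasurableSet {a | ⌊(κ a univ).toReal⌋₊ = n} := fun n =>
    (Nat.measurable_floor.comp (κ.measurable_coe MeasurableSet.univ).ennreal_toReal)
      (measurableSet_singleton n)
  refine ⟨fun n => Kernel.piecewise (hs n) κ 0, fun n => ⟨n + 1, ?_, fun a => ?_⟩, ?_⟩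
  · simp
  · rw [Kernel.piecewise_apply]
    split_ifs with ha
    · rw [← ENNReal.ofReal_toReal (measure_ne_top (κ a) univ)]
      refine ENNReal.ofReal_le_of_le_toReal ?_
      have := Nat.lt_floor_add_one (κ a univ).toReal
      simp only [mem_ofPred_eq] at ha
      rw [ha] at this
      simpa [ENNReal.toReal_add] using this.le
    · simp
  · ext a B hB
    rw [Kernel.sum_apply' _ _ hB, tsum_eq_single ⌊(κ a univ).toReal⌋₊]
    · simp [Kernel.piecewise_apply]
    · intro n hn
      rw [Kernel.piecewise_apply, if_neg]
      · simp
      · exact fun h => hn h.symm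

theorem measurable_rightLim {Ω : Type*} {_ : MeasurableSpace Ω} {A : ℝ≥0 → Ω → ℝ} {u v : ℝ≥0}
    (hA : ∀ ω, Monotone fun u => A u ω) (huv : u < v) (hAm : ∀ w < v, Measurable (A w)) :
    Measurable fun ω => Function.rightLim (fun u => A u ω) u := by
  obtain ⟨w, -, hw, hlim⟩ := exists_seq_strictAnti_tendsto' huv
  refine measurable_of_tendsto_metrizable (f := fun n ω => A (w n) ω)
    (fun n => hAm _ (hw n).2) (tendsto_pi_nhds.mpr fun ω => ?_)
  exact ((hA ω).tendsto_rightLim u).comp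
    (tendsto_nhdsWithin_iff.mpr ⟨hlim, Eventually.of_forall fun n => (hw n).1⟩)

/-- The Stieltjes measure is built from right limits, so the mass of (u,v] requires a look beyond v,
but only up to an arbitrary w > v. -/
theorem measurable_stieltjesMeasure_Ioc {Ω : Type*} {_ : MeasurableSpace Ω} {A : ℝ≥0 → Ω → ℝ}
    (hA : ∀ ω, Monotone fun u => A u ω) {u v w : ℝ≥0} (hvw : v < w)
    (hAm : ∀ x < w, Measurable (A x)) :
    Measurable fun ω => (hA ω).stieltjesFunction.measure (Ioc u v) := by
  rcases le_total v u with huv | huv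
  · simp [Ioc_eq_empty huv.not_gt]
  simp only [StieltjesFunction.measure_Ioc, Monotone.stieltjesFunction_eq]
  exact ((measurable_rightLim hA hvw hAm).sub
    (measurable_rightLim hA (huv.trans_lt hvw) hAm)).ennreal_ofReal

/-- The random measure `dA` on `(a,b]`. -/
noncomputable def stieltjesKernel (A : ℝ≥0 → Ω → ℝ) (hAd : StronglyAdapted 𝓕 A)
    (hA : ∀ ω, Monotone fun u => A u ω) (a b : ℝ≥0) : Kernel Ω ℝ≥0 where
  toFun ω := (hA ω).stieltjesFunction.measure.restrict (Ioc a b)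
  measurable' := by
    have : ∀ ω, IsFiniteMeasure ((hA ω).stieltjesFunction.measure.restrict (Ioc a b)) := fun ω =>
      ⟨by simp [StieltjesFunction.measure_Ioc]⟩
    have hmeas : ∀ u v, Measurable fun ω => (hA ω).stieltjesFunction.measure (Ioc u v) :=
      fun u v => measurable_stieltjesMeasure_Ioc hA (lt_add_one v)
        fun x _ => (hAd x).measurable.mono (𝓕.le x) le_rfl
    refine Measurable.measure_of_isPiSystem
      ((BorelSpace.measurable_eq (α := ℝ≥0)).trans (borel_eq_generateFrom_Ioc ℝ≥0))
      (isPiSystem_Ioc id id) ?_ ?_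
    · rintro _ ⟨u, v, -, rfl⟩
      simpa [Measure.restrict_apply, Ioc_inter_Ioc] using hmeas _ _
    · simpa using hmeas a b

theorem stieltjesKernel_apply {A : ℝ≥0 → Ω → ℝ} (hAd : StronglyAdapted 𝓕 A)
    (hA : ∀ ω, Monotone fun u => A u ω) (a b : ℝ≥0) (ω : Ω) :
    stieltjesKernel A hAd hA a b ω = (hA ω).stieltjesFunction.measure.restrict (Ioc a b) :=
  rfl

instance isFiniteMeasure_stieltjesKernel {A : ℝ≥0 → Ω → ℝ} (hAd : StronglyAdapted 𝓕 A)
    (hA : ∀ ω, Monotone fun u => A u ω) (a b : ℝ≥0) (ω : Ω) :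
    IsFiniteMeasure (stieltjesKernel A hAd hA a b ω) :=
  ⟨by simp [stieltjesKernel_apply, StieltjesFunction.measure_Ioc]⟩

instance isSFiniteKernel_stieltjesKernel {A : ℝ≥0 → Ω → ℝ} (hAd : StronglyAdapted 𝓕 A)
    (hA : ∀ ω, Monotone fun u => A u ω) (a b : ℝ≥0) :
    IsSFiniteKernel (stieltjesKernel A hAd hA a b) :=
  isSFiniteKernel_of_isFiniteMeasure _ inferInstance

end Kernel

/-! ### Right-continuous processes -/

section RightContinuous

/-- A point of a grid of mesh `1 / (n + 1)` slightly to the right of `u`. -/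
noncomputable def gridPoint (n : ℕ) (k : ℕ) : ℝ≥0 := (k + 1) / (n + 1)

/-- The index of the cell of the grid of mesh `1 / (n + 1)` which contains `u`. -/
noncomputable def gridIndex (n : ℕ) (u : ℝ≥0) : ℕ := ⌈(n + 1) * u⌉₊

theorem measurable_gridIndex (n : ℕ) : Measurable (gridIndex n) :=
  Nat.measurable_ceil.comp (measurable_const_mul _)

/-- A cell of index k ends at k/(n+1), while the grid point is one mesh further. The strict
inequality leaves room for the look-ahead of right limits of A. -/
theorem lt_gridPoint (n : ℕ) (u : ℝ≥0) : u < gridPoint n (gridIndex n u) := by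
  have hn : (0 : ℝ≥0) < n + 1 := by positivity
  rw [gridPoint, lt_div_iff₀ hn, mul_comm]
  exact (Nat.le_ceil _).trans_lt (lt_add_one _)

theorem gridPoint_le (n : ℕ) (u : ℝ≥0) : gridPoint n (gridIndex n u) ≤ u + 2 / (n + 1) := by
  have hn : (0 : ℝ≥0) < n + 1 := by positivity
  rw [gridPoint, div_le_iff₀ hn, add_mul, div_mul_cancel₀ _ hn.ne', mul_comm u]
  have h : (gridIndex n u : ℝ≥0) < (n + 1) * u + 1 := Nat.ceil_lt_add_one zero_le
  calc (gridIndex n u : ℝ≥0) + 1 ≤ (n + 1) * u + 1 + 1 := by gcongr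
    _ = (n + 1) * u + 2 := by rw [add_assoc]; norm_num

theorem tendsto_gridPoint (u : ℝ≥0) :
    Tendsto (fun n => gridPoint n (gridIndex n u)) atTop (𝓝[>] u) := by
  refine tendsto_nhdsWithin_iff.mpr ⟨?_, Eventually.of_forall fun n => lt_gridPoint n u⟩
  refine tendsto_of_tendsto_of_tendsto_of_le_of_le tendsto_const_nhds ?_
    (fun n => (lt_gridPoint n u).le) (fun n => gridPoint_le n u)
  have h : Tendsto (fun n : ℕ => (2 : ℝ≥0) / ((n + 1 : ℕ) : ℝ≥0)) atTop (𝓝 0) :=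
    (tendsto_const_div_atTop_nhds_zero_nat (2 : ℝ≥0)).comp (tendsto_add_atTop_nat 1)
  simpa using h.const_add u

theorem gridIndex_preimage_succ (n k : ℕ) :
    gridIndex n ⁻¹' {k + 1} = Ioc ((k : ℝ≥0) / (n + 1)) ((k + 1) / (n + 1)) := by
  have hn : (0 : ℝ≥0) < n + 1 := by positivity
  ext u
  simp only [mem_preimage, mem_singleton_iff, mem_Ioc, gridIndex]
  rw [Nat.ceil_eq_iff (Nat.succ_ne_zero k), div_lt_iff₀ hn, le_div_iff₀ hn, mul_comm]
  simp

theorem gridIndex_preimage_zero (n : ℕ) : gridIndex n ⁻¹' {0} = {0} := by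
  ext u
  simp [gridIndex]

variable {Ω E : Type*} {m : MeasurableSpace Ω} [MeasurableSpace E]

theorem measurable_gridIndex_comp {g : ℕ → Ω → E} (hg : ∀ k, Measurable (g k)) (n : ℕ) :
    Measurable fun p : ℝ≥0 × Ω => g (gridIndex n p.1) p.2 := by
  have h : Measurable fun p : ℕ × Ω => g p.1 p.2 := measurable_from_prod_countable_right hg
  exact h.comp ((measurable_gridIndex n).prodMap measurable_id)

/-- Sampling at the grid point to the right of u makes the process depend on u through a countable
index; right-continuity recovers it in the limit. -/
theorem measurable_uncurry_of_rightContinuous [TopologicalSpace E]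
    [TopologicalSpace.PseudoMetrizableSpace E] [BorelSpace E] {f : ℝ≥0 → Ω → E}
    (hf : ∀ u, Measurable (f u))
    (hr : ∀ ω u, ContinuousWithinAt (fun u => f u ω) (Ici u) u) :
    Measurable fun p : ℝ≥0 × Ω => f p.1 p.2 := by
  have h : ∀ n, Measurable fun p : ℝ≥0 × Ω => f (gridPoint n (gridIndex n p.1)) p.2 := fun n =>
    measurable_gridIndex_comp (g := fun k => f (gridPoint n k)) (fun k => hf (gridPoint n k)) n
  refine measurable_of_tendsto_metrizable h (tendsto_pi_nhds.mpr fun p => ?_)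
  exact ((hr p.2 p.1).mono_left (nhdsWithin_mono _ Ioi_subset_Ici_self)).comp
    (tendsto_gridPoint p.1)

end RightContinuous

/-! ### Dual predictable projections of adapted random measures -/

section Projection

open ProbabilityTheory

variable {Ω : Type*} {m : MeasurableSpace Ω} {P : Measure Ω} [IsProbabilityMeasure P]
  {𝓕 : Filtration ℝ≥0 m} {A : ℝ≥0 → Ω → ℝ} {a b : ℝ≥0}

theorem predictable_le_prod (𝓕 : Filtration ℝ≥0 m) :
    𝓕.predictable ≤ (inferInstance : MeasurableSpace (ℝ≥0 × Ω)) :=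
  measurableSpace_le_predictable_of_measurableSet
    (fun _ hB => (measurableSet_singleton _).prod (𝓕.le _ _ hB))
    (fun _ _ hB => measurableSet_Ioi.prod (𝓕.le _ _ hB))

theorem isPiSystem_predictable (𝓕 : Filtration ℝ≥0 m) :
    IsPiSystem ({s : Set (ℝ≥0 × Ω) | ∃ B, MeasurableSet[𝓕 ⊥] B ∧ s = {⊥} ×ˢ B} ∪
      {s | ∃ i B, MeasurableSet[𝓕 i] B ∧ s = Ioi i ×ˢ B}) := by
  rintro _ (⟨B, hB, rfl⟩ | ⟨i, B, hB, rfl⟩) _ (⟨B', hB', rfl⟩ | ⟨j, B', hB', rfl⟩) hne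
  · left
    exact ⟨B ∩ B', hB.inter hB', by rw [prod_inter_prod, inter_self]⟩
  · obtain ⟨⟨u, ω⟩, ⟨hu, -⟩, ⟨hu', -⟩⟩ := hne
    simp only [mem_singleton_iff, mem_Ioi] at hu hu'
    simp [hu] at hu'
  · obtain ⟨⟨u, ω⟩, ⟨hu, -⟩, ⟨hu', -⟩⟩ := hne
    simp only [mem_singleton_iff, mem_Ioi] at hu hu'
    simp [hu'] at hu
  · right
    refine ⟨max i j, B ∩ B', ?_, ?_⟩
    · exact (𝓕.mono (le_max_left i j) _ hB).inter (𝓕.mono (le_max_right i j) _ hB')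
    · rw [prod_inter_prod, Ioi_inter_Ioi]

/-- By monotonicity the set is an interval starting at a. Its mass is bounded by f, or its left
limit, at the supremum, minus f(a) ≥ 0, according to whether the supremum is attained. This
localises a random measure whose total mass need not be integrable. -/
theorem stieltjesMeasure_restrict_lt_le (f : StieltjesFunction ℝ≥0) (hf : ∀ u, 0 ≤ f u)
    (a b : ℝ≥0) (N : ℝ) :
    f.measure.restrict (Ioc a b) {u | f u < N} ≤ ENNReal.ofReal N := by
  have hmeas : MeasurableSet {u | f u < N} := f.mono.measurable measurableSet_Iio
  rw [Measure.restrict_apply hmeas]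
  set J := {u | f u < N} ∩ Ioc a b with hJ
  rcases J.eq_empty_or_nonempty with h | hne
  · simp [h]
  have hbdd : BddAbove J := ⟨b, fun u hu => hu.2.2⟩
  obtain ⟨u₀, hu₀⟩ := hne
  have has : a < sSup J := hu₀.2.1.trans_le (le_csSup hbdd hu₀)
  by_cases hs : sSup J ∈ J
  · calc f.measure J ≤ f.measure (Ioc a (sSup J)) :=
          measure_mono fun u hu => ⟨hu.2.1, le_csSup hbdd hu⟩
      _ ≤ ENNReal.ofReal N := by
          rw [StieltjesFunction.measure_Ioc]
          exact ENNReal.ofReal_le_ofReal (by linarith [hf a, hs.1.out])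
  · calc f.measure J ≤ f.measure (Ioo a (sSup J)) :=
          measure_mono fun u hu => ⟨hu.2.1, (le_csSup hbdd hu).lt_of_ne fun h => hs (h ▸ hu)⟩
      _ ≤ ENNReal.ofReal N := by
          rw [StieltjesFunction.measure_Ioo]
          have : (𝓝[<] (sSup J)).NeBot := nhdsLT_neBot_of_exists_lt ⟨a, has⟩
          have h : Function.leftLim f (sSup J) ≤ N := by
            refine le_of_tendsto (f.mono.tendsto_leftLim _) ?_
            filter_upwards [self_mem_nhdsWithin] with v hv
            obtain ⟨u, hu, hvu⟩ := exists_lt_of_lt_csSup ⟨u₀, hu₀⟩ hv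
            exact (f.mono hvu.le).trans hu.1.out.le
          exact ENNReal.ofReal_le_ofReal (by linarith [hf a])

/-- The Doléans measure `dA dP` on `(a,b] × Ω`. -/
noncomputable def doleansMeasure (P : Measure Ω) (A : ℝ≥0 → Ω → ℝ) (hAd : StronglyAdapted 𝓕 A)
    (hA : ∀ ω, Monotone fun u => A u ω) (a b : ℝ≥0) : Measure (ℝ≥0 × Ω) :=
  (P ⊗ₘ stieltjesKernel A hAd hA a b).map Prod.swap

theorem lintegral_doleansMeasure (hAd : StronglyAdapted 𝓕 A) (hA : ∀ ω, Monotone fun u => A u ω)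
    {g : ℝ≥0 × Ω → ℝ≥0∞} (hg : Measurable g) :
    ∫⁻ p, g p ∂(doleansMeasure P A hAd hA a b) =
      ∫⁻ ω, ∫⁻ u in Ioc a b, g (u, ω) ∂(hA ω).stieltjesFunction.measure ∂P := by
  rw [doleansMeasure, lintegral_map hg measurable_swap]
  exact Measure.lintegral_compProd (hg.comp measurable_swap)

/-- The set where the right limit of `A` is below the level `N`. -/
def levelSet (A : ℝ≥0 → Ω → ℝ) (N : ℕ) : Set (ℝ≥0 × Ω) :=
  {p | Function.rightLim (fun u => A u p.2) p.1 < N}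

theorem measurableSet_levelSet (hAd : StronglyAdapted 𝓕 A) (hA : ∀ ω, Monotone fun u => A u ω)
    (N : ℕ) : MeasurableSet (levelSet A N) := by
  have h : Measurable fun p : ℝ≥0 × Ω => Function.rightLim (fun u => A u p.2) p.1 :=
    measurable_uncurry_of_rightContinuous (f := fun u ω => Function.rightLim (fun u => A u ω) u)
      (fun u => measurable_rightLim hA (lt_add_one u)
        fun w _ => (hAd w).measurable.mono (𝓕.le w) le_rfl)
      (fun ω u => (hA ω).stieltjesFunction.right_continuous u)
  exact h measurableSet_Iio

theorem doleansMeasure_levelSet_ne_top (hAd : StronglyAdapted 𝓕 A)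
    (hA : ∀ ω, Monotone fun u => A u ω) (hA0 : ∀ u ω, 0 ≤ A u ω) (N : ℕ) :
    doleansMeasure P A hAd hA a b (levelSet A N) ≠ ∞ := by
  have hm := measurableSet_levelSet hAd hA N
  rw [← lintegral_indicator_one hm, lintegral_doleansMeasure hAd hA (measurable_one.indicator hm)]
  refine ne_top_of_le_ne_top (ENNReal.ofReal_ne_top (r := N)) ?_
  calc _ ≤ ∫⁻ _, ENNReal.ofReal N ∂P := by
        refine lintegral_mono fun ω => ?_
        have hs : MeasurableSet {u | (hA ω).stieltjesFunction u < N} :=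
          (hA ω).stieltjesFunction.mono.measurable measurableSet_Iio
        refine le_trans (le_of_eq ?_) (stieltjesMeasure_restrict_lt_le (hA ω).stieltjesFunction
          (fun u => (hA0 u ω).trans ((hA ω).le_rightLim le_rfl)) a b N)
        rw [← lintegral_indicator_one hs]
        rfl
    _ = ENNReal.ofReal N := by simp

/-- Riemann sum approximation of the indicator of a predictable rectangle, cut at the level `N`
of `A`, times the process `f`. -/
noncomputable def riemannApprox (A : ℝ≥0 → Ω → ℝ) (f : ℝ≥0 → Ω → ℝ≥0∞) (r : ℝ≥0) (B : Set Ω)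
    (N n : ℕ) (p : ℝ≥0 × Ω) : ℝ≥0∞ :=
  (Ioi r).indicator 1 p.1 * (B.indicator 1 p.2 *
    {ω | A (gridPoint n (gridIndex n p.1)) ω < N}.indicator 1 p.2 *
      f (gridPoint n (gridIndex n p.1)) p.2)

theorem measurable_riemannApprox (hAd : StronglyAdapted 𝓕 A) {f : ℝ≥0 → Ω → ℝ≥0∞}
    (hf : ∀ u, Measurable (f u)) (r : ℝ≥0) {B : Set Ω} (hB : MeasurableSet B) (N n : ℕ) :
    Measurable (riemannApprox A f r B N n) := by
  refine Measurable.mul ((measurable_one.indicator measurableSet_Ioi).comp measurable_fst) ?_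
  refine measurable_gridIndex_comp (g := fun k ω => B.indicator 1 ω *
    {ω | A (gridPoint n k) ω < N}.indicator 1 ω * f (gridPoint n k) ω) (fun k => ?_) n
  have hs : MeasurableSet {ω | A (gridPoint n k) ω < N} :=
    ((hAd _).measurable.mono (𝓕.le _) le_rfl) measurableSet_Iio
  exact ((measurable_one.indicator hB).mul (measurable_one.indicator hs)).mul (hf _)

/-- On a cell the approximant depends on ω alone, so the integral becomes a sum of terms E[ψ_k f_s],
with s the grid point and ψ_k the mass of the cell times indicators. -/
theorem lintegral_riemannApprox (hAd : StronglyAdapted 𝓕 A) (hA : ∀ ω, Monotone fun u => A u ω)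
    {f : ℝ≥0 → Ω → ℝ≥0∞} (hf : ∀ u, Measurable (f u)) (r : ℝ≥0) {B : Set Ω} (hB : MeasurableSet B)
    (N n : ℕ) :
    ∫⁻ p, riemannApprox A f r B N n p ∂(doleansMeasure P A hAd hA a b) =
      ∑' k : ℕ, ∫⁻ ω, (hA ω).stieltjesFunction.measure (gridIndex n ⁻¹' {k} ∩ Ioi r ∩ Ioc a b) *
        (B.indicator 1 ω * {ω | A (gridPoint n k) ω < N}.indicator 1 ω) * f (gridPoint n k) ω
        ∂P := by
  rw [lintegral_doleansMeasure hAd hA (measurable_riemannApprox hAd hf r hB N n), ← lintegral_tsum]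
  · refine lintegral_congr fun ω => ?_
    set μ := (hA ω).stieltjesFunction.measure with hμ
    set h : ℕ → ℝ≥0∞ := fun k => B.indicator 1 ω *
      {ω | A (gridPoint n k) ω < N}.indicator 1 ω * f (gridPoint n k) ω with hh
    calc ∫⁻ u in Ioc a b, riemannApprox A f r B N n (u, ω) ∂μ
        = ∫⁻ u in Ioc a b, (Ioi r).indicator (fun u => h (gridIndex n u)) u ∂μ := by
          refine lintegral_congr fun u => ?_
          by_cases hu : u ∈ Ioi r <;> simp [riemannApprox, hh, hu]
      _ = ∫⁻ u in Ioi r ∩ Ioc a b, h (gridIndex n u) ∂μ := by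
          rw [lintegral_indicator measurableSet_Ioi, Measure.restrict_restrict measurableSet_Ioi]
      _ = ∑' k, h k * (μ.restrict (Ioi r ∩ Ioc a b)).map (gridIndex n) {k} := by
          rw [← lintegral_countable', lintegral_map (measurable_of_countable _)
            (measurable_gridIndex n)]
      _ = _ := by
          refine tsum_congr fun k => ?_
          rw [Measure.map_apply (measurable_gridIndex n) (measurableSet_singleton k),
            Measure.restrict_apply (measurable_gridIndex n (measurableSet_singleton k)),
            inter_assoc]
          ring
  · intro k
    have hs : MeasurableSet {ω | A (gridPoint n k) ω < N} :=
      ((hAd _).measurable.mono (𝓕.le _) le_rfl) measurableSet_Iio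
    refine Measurable.aemeasurable (Measurable.mul (Measurable.mul ?_
      ((measurable_one.indicator hB).mul (measurable_one.indicator hs))) (hf _))
    have h := (stieltjesKernel A hAd hA a b).measurable_coe
      ((measurable_gridIndex n (measurableSet_singleton k)).inter (measurableSet_Ioi (a := r)))
    simpa only [stieltjesKernel_apply, Measure.restrict_apply
      ((measurable_gridIndex n (measurableSet_singleton k)).inter (measurableSet_Ioi (a := r)))]
      using h

theorem measurable_indicator_one_ennreal {Ω : Type*} {_ : MeasurableSpace Ω} {B : Set Ω}
    (hB : MeasurableSet B) : Measurable (B.indicator (1 : Ω → ℝ≥0∞)) :=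
  measurable_one.indicator hB

/-- The weight ψ_k is known at the grid time, which lies strictly after the cell. If r exceeds that
time, B may not be known yet, but then the cell misses (r,∞) and the weight is 0; the cell {0} of
index 0 is excluded likewise. -/
theorem measurable_stieltjesMeasure_cell (hAd : StronglyAdapted 𝓕 A)
    (hA : ∀ ω, Monotone fun u => A u ω) {r : ℝ≥0} {B : Set Ω} (hB : MeasurableSet[𝓕 r] B)
    (N n k : ℕ) :
    Measurable[𝓕 (gridPoint n k)] fun ω =>
      (hA ω).stieltjesFunction.measure (gridIndex n ⁻¹' {k} ∩ Ioi r ∩ Ioc a b) *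
        (B.indicator 1 ω * {ω | A (gridPoint n k) ω < N}.indicator 1 ω) := by
  have hn : (0 : ℝ≥0) < n + 1 := by positivity
  rcases k with _ | k
  · have : gridIndex n ⁻¹' {0} ∩ Ioi r ∩ Ioc a b = ∅ := by
      rw [gridIndex_preimage_zero]
      refine eq_empty_of_forall_notMem ?_
      rintro u ⟨⟨rfl, h⟩, -⟩
      exact not_lt_zero (show r < 0 from h)
    simp only [this, measure_empty, zero_mul]
    exact @measurable_const _ _ _ (_) _
  · have hlt : ((k : ℝ≥0) + 1) / (n + 1) < gridPoint n (k + 1) := by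
      rw [gridPoint]
      push_cast
      gcongr
      exact lt_add_one _
    rw [gridIndex_preimage_succ, Ioc_inter_Ioi, Ioc_inter_Ioc]
    by_cases hr : r ≤ gridPoint n (k + 1)
    · have hm : Measurable[𝓕 (gridPoint n (k + 1))] fun ω => (hA ω).stieltjesFunction.measure
          (Ioc (max (max ((k : ℝ≥0) / (n + 1)) r) a) (min ((k + 1) / (n + 1)) b)) :=
        measurable_stieltjesMeasure_Ioc hA ((min_le_left _ _).trans_lt hlt)
          fun x hx => (hAd x).measurable.mono (𝓕.mono hx.le) le_rfl
      have hs : MeasurableSet[𝓕 (gridPoint n (k + 1))] {ω | A (gridPoint n (k + 1)) ω < N} :=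
        (hAd _).measurable measurableSet_Iio
      exact @Measurable.mul _ _ _ _ _ (_) _ _ hm (@Measurable.mul _ _ _ _ _ (_) _ _
        (measurable_indicator_one_ennreal (𝓕.mono hr B hB))
        (measurable_indicator_one_ennreal hs))
    · have : Ioc (max (max ((k : ℝ≥0) / (n + 1)) r) a) (min ((k + 1) / (n + 1)) b) = ∅ := by
        refine Ioc_eq_empty fun h => hr ?_
        exact (((le_max_right _ _).trans (le_max_left _ _)).trans_lt
          (h.trans_le (min_le_left _ _))).le.trans hlt.le
      simp only [this, measure_empty, zero_mul]
      exact @measurable_const _ _ _ (_) _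

/-- The cut-off A < N at the grid point is compatible with `levelSet`: A there dominates the right
limit at u and converges to it, so the cut-off holds eventually on the level set and never off it.
-/
theorem tendsto_riemannApprox (hA : ∀ ω, Monotone fun u => A u ω) {f : ℝ≥0 → Ω → ℝ≥0∞}
    (hr : ∀ ω u, ContinuousWithinAt (fun u => f u ω) (Ici u) u)
    (r : ℝ≥0) (B : Set Ω) (N : ℕ) (p : ℝ≥0 × Ω) :
    Tendsto (fun n => riemannApprox A f r B N n p) atTop
      (𝓝 ((Ioi r ×ˢ B).indicator 1 p * (levelSet A N).indicator (fun p => f p.1 p.2) p)) := by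
  obtain ⟨u, ω⟩ := p
  have hf := ((hr ω u).mono_left (nhdsWithin_mono _ Ioi_subset_Ici_self)).comp (tendsto_gridPoint u)
  by_cases hu : u ∈ Ioi r
  swap
  · simp [riemannApprox, hu]
  by_cases hω : ω ∈ B
  swap
  · simp [riemannApprox, hω]
  by_cases hN : (u, ω) ∈ levelSet A N
  · have hev := (((hA ω).tendsto_rightLim u).comp (tendsto_gridPoint u)).eventually_lt_const hN.out
    have : (Ioi r ×ˢ B).indicator 1 (u, ω) * (levelSet A N).indicator (fun p => f p.1 p.2) (u, ω)
        = f u ω := by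
      rw [indicator_of_mem (mk_mem_prod hu hω), indicator_of_mem hN]
      simp
    rw [this]
    refine hf.congr' ?_
    filter_upwards [hev] with n hn
    have hn' : A (gridPoint n (gridIndex n u)) ω < N := hn
    simp [riemannApprox, hu, hω, hn']
  · have hz : ∀ n, riemannApprox A f r B N n (u, ω) = 0 := by
      intro n
      have h1 : ¬ A (gridPoint n (gridIndex n u)) ω < N := fun h =>
        hN (((hA ω).rightLim_le (lt_gridPoint n u)).trans_lt h)
      simp [riemannApprox, h1]
    simp [hz, hN]

theorem riemannApprox_le (hA : ∀ ω, Monotone fun u => A u ω) {f : ℝ≥0 → Ω → ℝ≥0∞}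
    (hf1 : ∀ u ω, f u ω ≤ 1) (r : ℝ≥0) (B : Set Ω) (N n : ℕ) (p : ℝ≥0 × Ω) :
    riemannApprox A f r B N n p ≤ (levelSet A N).indicator 1 p := by
  obtain ⟨u, ω⟩ := p
  by_cases h : A (gridPoint n (gridIndex n u)) ω < N
  · have hN : (u, ω) ∈ levelSet A N := ((hA ω).rightLim_le (lt_gridPoint n u)).trans_lt h
    rw [indicator_of_mem hN]
    refine mul_le_one' (indicator_le_self' (by simp) _) (mul_le_one' (mul_le_one'
      (indicator_le_self' (by simp) _) (indicator_le_self' (by simp) _)) (hf1 _ _))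
  · simp [riemannApprox, h]

/-- For each mesh the Riemann sums of f and g agree term by term by `hfg`; dominated convergence
applies because the level set has finite Doléans measure. -/
theorem lintegral_rect_levelSet_eq (hAd : StronglyAdapted 𝓕 A) (hA : ∀ ω, Monotone fun u => A u ω)
    (hA0 : ∀ u ω, 0 ≤ A u ω) {f g : ℝ≥0 → Ω → ℝ≥0∞}
    (hfm : ∀ u, Measurable (f u)) (hgm : ∀ u, Measurable (g u))
    (hf1 : ∀ u ω, f u ω ≤ 1) (hg1 : ∀ u ω, g u ω ≤ 1)
    (hfr : ∀ ω u, ContinuousWithinAt (fun u => f u ω) (Ici u) u)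
    (hgr : ∀ ω u, ContinuousWithinAt (fun u => g u ω) (Ici u) u)
    (hfg : ∀ u (ψ : Ω → ℝ≥0∞), Measurable[𝓕 u] ψ → ∫⁻ ω, ψ ω * f u ω ∂P = ∫⁻ ω, ψ ω * g u ω ∂P)
    {r : ℝ≥0} {B : Set Ω} (hB : MeasurableSet[𝓕 r] B) (N : ℕ) :
    ∫⁻ p, (Ioi r ×ˢ B).indicator 1 p * (levelSet A N).indicator (fun p => f p.1 p.2) p
        ∂(doleansMeasure P A hAd hA a b) =
      ∫⁻ p, (Ioi r ×ˢ B).indicator 1 p * (levelSet A N).indicator (fun p => g p.1 p.2) p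
        ∂(doleansMeasure P A hAd hA a b) := by
  have hBm := 𝓕.le r B hB
  have hlim : ∀ h : ℝ≥0 → Ω → ℝ≥0∞, (∀ u, Measurable (h u)) → (∀ u ω, h u ω ≤ 1) →
      (∀ ω u, ContinuousWithinAt (fun u => h u ω) (Ici u) u) →
      Tendsto (fun n => ∫⁻ p, riemannApprox A h r B N n p ∂(doleansMeasure P A hAd hA a b)) atTop
        (𝓝 (∫⁻ p, (Ioi r ×ˢ B).indicator 1 p * (levelSet A N).indicator (fun p => h p.1 p.2) p
          ∂(doleansMeasure P A hAd hA a b))) := by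
    intro h hm h1 hr
    refine tendsto_lintegral_of_dominated_convergence ((levelSet A N).indicator 1)
      (fun n => measurable_riemannApprox hAd hm r hBm N n)
      (fun n => Eventually.of_forall (riemannApprox_le hA h1 r B N n)) ?_
      (Eventually.of_forall (tendsto_riemannApprox hA hr r B N))
    rw [lintegral_indicator_one (measurableSet_levelSet hAd hA N)]
    exact doleansMeasure_levelSet_ne_top hAd hA hA0 N
  refine tendsto_nhds_unique (hlim f hfm hf1 hfr) ((hlim g hgm hg1 hgr).congr fun n => ?_)
  rw [lintegral_riemannApprox hAd hA hfm r hBm, lintegral_riemannApprox hAd hA hgm r hBm]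
  exact tsum_congr fun k =>
    (hfg _ _ (measurable_stieltjesMeasure_cell hAd hA hB N n k)).symm

/-- If `E[ψ f_u] = E[ψ g_u]` for all `u` and all `𝓕_u`-measurable `ψ ≥ 0`, then the processes
`f` and `g` have the same integrals against predictable processes and adapted random measures. -/
theorem lintegral_doleansMeasure_predictable_eq (hAd : StronglyAdapted 𝓕 A)
    (hA : ∀ ω, Monotone fun u => A u ω)
    (hA0 : ∀ u ω, 0 ≤ A u ω) {f g : ℝ≥0 → Ω → ℝ≥0∞}
    (hfm : ∀ u, Measurable (f u)) (hgm : ∀ u, Measurable (g u))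
    (hf1 : ∀ u ω, f u ω ≤ 1) (hg1 : ∀ u ω, g u ω ≤ 1)
    (hfr : ∀ ω u, ContinuousWithinAt (fun u => f u ω) (Ici u) u)
    (hgr : ∀ ω u, ContinuousWithinAt (fun u => g u ω) (Ici u) u)
    (hfg : ∀ u (ψ : Ω → ℝ≥0∞), Measurable[𝓕 u] ψ → ∫⁻ ω, ψ ω * f u ω ∂P = ∫⁻ ω, ψ ω * g u ω ∂P)
    {H : ℝ≥0 × Ω → ℝ≥0∞} (hH : Measurable[𝓕.predictable] H) :
    ∫⁻ p, H p * f p.1 p.2 ∂(doleansMeasure P A hAd hA a b) =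
      ∫⁻ p, H p * g p.1 p.2 ∂(doleansMeasure P A hAd hA a b) := by
  set M := doleansMeasure P A hAd hA a b with hM
  have hle := predictable_le_prod 𝓕
  have hHm : Measurable H := hH.mono hle le_rfl
  have hjoint : ∀ h : ℝ≥0 → Ω → ℝ≥0∞, (∀ u, Measurable (h u)) →
      (∀ ω u, ContinuousWithinAt (fun u => h u ω) (Ici u) u) →
      ∀ N, Measurable ((levelSet A N).indicator fun p => h p.1 p.2) := fun h hm hr N =>
    (measurable_uncurry_of_rightContinuous hm hr).indicator (measurableSet_levelSet hAd hA N)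
  have hfJ := hjoint f hfm hfr
  have hgJ := hjoint g hgm hgr
  have hfin : ∀ h : ℝ≥0 → Ω → ℝ≥0∞, (∀ u ω, h u ω ≤ 1) → ∀ N,
      ∫⁻ p, (levelSet A N).indicator (fun p => h p.1 p.2) p ∂M ≠ ∞ := by
    intro h h1 N
    refine ne_top_of_le_ne_top (doleansMeasure_levelSet_ne_top (P := P) (a := a) (b := b)
      hAd hA hA0 N) ?_
    rw [← lintegral_indicator_one (measurableSet_levelSet hAd hA N)]
    exact lintegral_mono fun p => indicator_le_indicator (h1 _ _)
  -- The measure lives on times in (a,b], so the generators {0} × B of the predictable σ-algebra are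
  -- null.
  have hbot : ∀ B : Set Ω, MeasurableSet B → M (({⊥} : Set ℝ≥0) ×ˢ B) = 0 := by
    intro B hB
    rw [← lintegral_indicator_one ((measurableSet_singleton _).prod hB), hM,
      lintegral_doleansMeasure hAd hA
        (measurable_one.indicator ((measurableSet_singleton _).prod hB))]
    refine (lintegral_congr fun ω => ?_).trans lintegral_zero
    refine (setLIntegral_congr_fun (g := fun _ => 0) measurableSet_Ioc fun u hu => ?_).trans
      lintegral_zero
    refine indicator_of_notMem (fun h => ?_) _
    have h0 : u = ⊥ := h.1
    exact not_lt_bot (h0 ▸ hu.1)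
  -- The level set is defined through right limits and need not be predictable. It is therefore kept
  -- in the density, and only the resulting finite measures are compared on predictable sets, by the
  -- π-λ theorem.
  have key : ∀ N, (M.withDensity ((levelSet A N).indicator fun p => f p.1 p.2)).trim hle =
      (M.withDensity ((levelSet A N).indicator fun p => g p.1 p.2)).trim hle := by
    intro N
    have : IsFiniteMeasure
        (M.withDensity ((levelSet A N).indicator fun p => f p.1 p.2)) :=
      isFiniteMeasure_withDensity (hfin f hf1 N)
    have hrect : ∀ r B, MeasurableSet[𝓕 r] B →
        M.withDensity ((levelSet A N).indicator fun p => f p.1 p.2) (Ioi r ×ˢ B) =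
        M.withDensity ((levelSet A N).indicator fun p => g p.1 p.2) (Ioi r ×ˢ B) := by
      intro r B hB
      have hm : MeasurableSet (Ioi r ×ˢ B) := measurableSet_Ioi.prod (𝓕.le _ _ hB)
      have h := lintegral_rect_levelSet_eq (P := P) (a := a) (b := b) hAd hA hA0 hfm hgm hf1 hg1
        hfr hgr hfg hB N
      rw [withDensity_apply _ hm, withDensity_apply _ hm, ← lintegral_indicator hm,
        ← lintegral_indicator hm]
      convert h using 3 with p p <;> by_cases hp : p ∈ Ioi r ×ˢ B <;> simp [hp]
    have hzero : ∀ (h : ℝ≥0 × Ω → ℝ≥0∞) B, MeasurableSet B →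
        M.withDensity h (({⊥} : Set ℝ≥0) ×ˢ B) = 0 := fun h B hB =>
      withDensity_absolutelyContinuous M h (hbot B hB)
    refine @ext_of_generate_finite _ 𝓕.predictable _ _ _ rfl (isPiSystem_predictable 𝓕)
      (isFiniteMeasure_trim hle) ?_ ?_
    · rintro s hs
      rw [trim_measurableSet_eq hle (MeasurableSpace.measurableSet_generateFrom hs),
        trim_measurableSet_eq hle (MeasurableSpace.measurableSet_generateFrom hs)]
      rcases hs with ⟨B, hB, rfl⟩ | ⟨r, B, hB, rfl⟩
      · rw [hzero _ B (𝓕.le _ _ hB), hzero _ B (𝓕.le _ _ hB)]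
      · exact hrect r B hB
    · rw [trim_measurableSet_eq hle (@MeasurableSet.univ _ 𝓕.predictable),
        trim_measurableSet_eq hle (@MeasurableSet.univ _ 𝓕.predictable)]
      have hu : (univ : Set (ℝ≥0 × Ω)) = ({⊥} : Set ℝ≥0) ×ˢ univ ∪ Ioi ⊥ ×ˢ univ := by
        rw [← union_prod, ← insert_eq, Ioi_insert, Ici_bot, univ_prod_univ]
      have hd : Disjoint (({⊥} : Set ℝ≥0) ×ˢ (univ : Set Ω)) (Ioi ⊥ ×ˢ univ) := by
        rw [Set.disjoint_prod]
        left
        simp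
      rw [hu, measure_union hd (measurableSet_Ioi.prod MeasurableSet.univ),
        measure_union hd (measurableSet_Ioi.prod MeasurableSet.univ), hzero _ _ MeasurableSet.univ,
        hzero _ _ MeasurableSet.univ, hrect ⊥ univ MeasurableSet.univ]
  have key' : ∀ N, ∫⁻ p, H p * (levelSet A N).indicator (fun p => f p.1 p.2) p ∂M =
      ∫⁻ p, H p * (levelSet A N).indicator (fun p => g p.1 p.2) p ∂M := by
    intro N
    have h1 := lintegral_withDensity_eq_lintegral_mul M (hfJ N) hHm
    have h2 := lintegral_withDensity_eq_lintegral_mul M (hgJ N) hHm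
    rw [← lintegral_trim hle hH, key N, lintegral_trim hle hH, h2] at h1
    simpa only [Pi.mul_apply, mul_comm] using h1.symm
  have hlim : ∀ h : ℝ≥0 → Ω → ℝ≥0∞,
      (∀ N, Measurable ((levelSet A N).indicator fun p => h p.1 p.2)) →
      Tendsto (fun N => ∫⁻ p, H p * (levelSet A N).indicator (fun p => h p.1 p.2) p ∂M) atTop
        (𝓝 (∫⁻ p, H p * h p.1 p.2 ∂M)) := by
    intro h hJ
    refine lintegral_tendsto_of_tendsto_of_monotone (fun N => (hHm.mul (hJ N)).aemeasurable)
      (Eventually.of_forall fun p N N' hNN' => ?_) (Eventually.of_forall fun p => ?_)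
    · refine mul_le_mul_right (indicator_le_indicator_of_subset (fun q hq => ?_)
        (fun _ => zero_le) p) _
      exact lt_of_lt_of_le (show _ < (N : ℝ) from hq) (by exact_mod_cast hNN')
    · refine tendsto_const_nhds.congr' ?_
      obtain ⟨N₀, hN₀⟩ := exists_nat_gt (Function.rightLim (fun u => A u p.2) p.1)
      filter_upwards [eventually_ge_atTop N₀] with N hN
      rw [indicator_of_mem]
      exact hN₀.trans_le (by exact_mod_cast hN)
  exact tendsto_nhds_unique (hlim f hfJ) ((hlim g hgJ).congr fun N => (key' N).symm)

end Projection

/-! ### Optional projection of the survival indicator -/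

section Survival

variable {Ω : Type*} {m : MeasurableSpace Ω} {P : Measure Ω}
  {𝓕 : Filtration ℝ≥0 m} {τ : Ω → ℝ≥0} {S : ℝ≥0 → Ω → ℝ} {A : ℝ≥0 → Ω → ℝ} {t T : ℝ≥0}
  {R : ℝ≥0 → Ω → ℝ}

theorem IsAzemaSupermartingale.measurable_uncurry (hS : IsAzemaSupermartingale P 𝓕 τ S) :
    Measurable fun p : ℝ≥0 × Ω => S p.1 p.2 :=
  measurable_uncurry_of_rightContinuous
    (fun u => ((hS.adapted u).mono (𝓕.le u)).measurable) hS.rightContinuous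

variable [IsProbabilityMeasure P]

/-- The a.s. bounds at the countably many grid points extend to all times simultaneously by
right-continuity. -/
theorem IsAzemaSupermartingale.ae_forall_mem_Icc (hS : IsAzemaSupermartingale P 𝓕 τ S)
    (hτ : Measurable τ) : ∀ᵐ ω ∂P, ∀ u, S u ω ∈ Icc (0 : ℝ) 1 := by
  have h : ∀ᵐ ω ∂P, ∀ n k, S (gridPoint n k) ω ∈ Icc (0 : ℝ) 1 := by
    refine ae_all_iff.mpr fun n => ae_all_iff.mpr fun k => ?_
    filter_upwards [hS.ae_nonneg (gridPoint n k), hS.ae_le_one hτ (gridPoint n k)] with ω h0 h1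
    exact ⟨h0, h1⟩
  filter_upwards [h] with ω hω u
  exact isClosed_Icc.mem_of_tendsto (((hS.rightContinuous ω u).mono_left
    (nhdsWithin_mono _ Ioi_subset_Ici_self)).comp (tendsto_gridPoint u))
    (Eventually.of_forall fun n => hω _ _)

theorem continuousWithinAt_survival (ω : Ω) (u : ℝ≥0) :
    ContinuousWithinAt (fun u => {ω | u < τ ω}.indicator (1 : Ω → ℝ≥0∞) ω) (Ici u) u := by
  by_cases h : u < τ ω
  · refine (tendsto_const_nhds (x := {ω | u < τ ω}.indicator (1 : Ω → ℝ≥0∞) ω)).congr' ?_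
    filter_upwards [mem_nhdsWithin_of_mem_nhds (Iio_mem_nhds h)] with v hv
    have hv' : v < τ ω := hv
    simp [h, hv']
  · refine (tendsto_const_nhds (x := {ω | u < τ ω}.indicator (1 : Ω → ℝ≥0∞) ω)).congr' ?_
    filter_upwards [self_mem_nhdsWithin] with v hv
    have hv' : ¬ v < τ ω := fun h' => h (lt_of_le_of_lt hv h')
    simp [h, hv']

theorem measurable_predictable_indicator_Ioi {ξ : Ω → ℝ≥0∞} (hξ : Measurable[𝓕 t] ξ) :
    Measurable[𝓕.predictable] fun p : ℝ≥0 × Ω => (Ioi t).indicator (fun _ => ξ p.2) p.1 := by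
  intro s hs
  have h1 : MeasurableSet[𝓕.predictable] (Ioi t ×ˢ (ξ ⁻¹' s)) :=
    measurableSet_predictable_Ioi_prod (hξ hs)
  have h2 : MeasurableSet[𝓕.predictable] (Ioi t ×ˢ (univ : Set Ω)) :=
    measurableSet_predictable_Ioi_prod (@MeasurableSet.univ _ (𝓕 t))
  by_cases h0 : (0 : ℝ≥0∞) ∈ s
  · have : (fun p : ℝ≥0 × Ω => (Ioi t).indicator (fun _ => ξ p.2) p.1) ⁻¹' s =
        Ioi t ×ˢ (ξ ⁻¹' s) ∪ (Ioi t ×ˢ (univ : Set Ω))ᶜ := by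
      ext ⟨u, ω⟩
      by_cases hu : t < u <;> simp [hu, h0]
    rw [this]
    exact h1.union h2.compl
  · have : (fun p : ℝ≥0 × Ω => (Ioi t).indicator (fun _ => ξ p.2) p.1) ⁻¹' s =
        Ioi t ×ˢ (ξ ⁻¹' s) := by
      ext ⟨u, ω⟩
      by_cases hu : t < u <;> simp [hu, h0]
    rw [this]
    exact h1

/-- Integrals of predictable processes over `(0,τ)` against an adapted random measure. -/
theorem IsAzemaSupermartingale.lintegral_predictable_eq (hS : IsAzemaSupermartingale P 𝓕 τ S)
    (hτ : Measurable τ) (hAd : StronglyAdapted 𝓕 A) (hA : ∀ ω, Monotone fun u => A u ω)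
    (hA0 : ∀ u ω, 0 ≤ A u ω) {H : ℝ≥0 × Ω → ℝ≥0∞} (hH : Measurable[𝓕.predictable] H) :
    ∫⁻ ω, ∫⁻ u in Ioc t T, H (u, ω) * {ω | u < τ ω}.indicator 1 ω
        ∂(hA ω).stieltjesFunction.measure ∂P =
      ∫⁻ ω, ∫⁻ u in Ioc t T, H (u, ω) * ENNReal.ofReal (S u ω)
        ∂(hA ω).stieltjesFunction.measure ∂P := by
  have hHm : Measurable H := hH.mono (predictable_le_prod 𝓕) le_rfl
  have hlt : ∀ u, MeasurableSet {ω | u < τ ω} := fun u => measurableSet_lt measurable_const hτ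
  have h1m : ∀ u, Measurable ({ω | u < τ ω}.indicator (1 : Ω → ℝ≥0∞)) := fun u =>
    measurable_one.indicator (hlt u)
  -- S ≤ 1 holds only almost surely, while the projection theorem asks for a bound everywhere; S is
  -- capped at 1 and the cap removed a.s. afterwards.
  have h2m : ∀ u, Measurable fun ω => min (ENNReal.ofReal (S u ω)) 1 := fun u =>
    ((hS.adapted u).mono (𝓕.le u)).measurable.ennreal_ofReal.min measurable_const
  have h2r : ∀ ω u, ContinuousWithinAt (fun u => min (ENNReal.ofReal (S u ω)) 1) (Ici u) u :=
    fun ω u => ((ENNReal.continuous_ofReal.tendsto _).comp (hS.rightContinuous ω u)).min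
      tendsto_const_nhds
  have h := lintegral_doleansMeasure_predictable_eq (P := P) (a := t) (b := T) hAd hA hA0 h1m h2m
    (fun u ω => indicator_le_self' (by simp) ω) (fun u ω => min_le_right _ _)
    (fun ω u => continuousWithinAt_survival ω u) h2r (fun u ψ hψ => ?_) hH
  · rw [lintegral_doleansMeasure hAd hA (g := fun p => H p * {ω | p.1 < τ ω}.indicator 1 p.2)
        (hHm.mul (measurable_uncurry_of_rightContinuous h1m continuousWithinAt_survival)),
      lintegral_doleansMeasure hAd hA (g := fun p => H p * min (ENNReal.ofReal (S p.1 p.2)) 1)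
        (hHm.mul (measurable_uncurry_of_rightContinuous h2m h2r))] at h
    rw [h]
    refine lintegral_congr_ae ?_
    filter_upwards [hS.ae_forall_mem_Icc hτ] with ω hω
    refine lintegral_congr fun u => ?_
    rw [min_eq_left (ENNReal.ofReal_le_one.mpr (hω u).2)]
  · have h1 : ∫⁻ ω, ψ ω * {ω | u < τ ω}.indicator 1 ω ∂P
        = ∫⁻ ω, {ω | u < τ ω}.indicator ψ ω ∂P := by
      refine lintegral_congr fun ω => ?_
      by_cases h : u < τ ω <;> simp [h]
    rw [h1, ← (hS.isCondDensity hτ u).lintegral_mul (𝓕.le u) (hlt u)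
      (hS.aestronglyMeasurable u).aemeasurable.ennreal_ofReal hψ]
    refine lintegral_congr_ae ?_
    filter_upwards [hS.ae_le_one hτ u] with ω hω
    rw [min_eq_left (ENNReal.ofReal_le_one.mpr hω)]

/-- The factor 1_B R_t is 𝓕_t-measurable, hence becomes predictable once restricted to times after
t, and can be absorbed into the predictable integrand together with 1/R_u. -/
theorem IsAzemaSupermartingale.setLIntegral_discounted_eq (hS : IsAzemaSupermartingale P 𝓕 τ S)
    (hτ : Measurable τ) (hAd : StronglyAdapted 𝓕 A) (hA : ∀ ω, Monotone fun u => A u ω)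
    (hA0 : ∀ u ω, 0 ≤ A u ω) (hR : IsStronglyPredictable 𝓕 R) (hRpos : ∀ u ω, 0 < R u ω)
    {B : Set Ω} (hB : MeasurableSet[𝓕 t] B) :
    ∫⁻ ω in B, ∫⁻ u in Ioc t T, ENNReal.ofReal
        ({ω | u < τ ω}.indicator (fun _ => (1 : ℝ)) ω * (R t ω / R u ω))
        ∂(hA ω).stieltjesFunction.measure ∂P =
      ∫⁻ ω in B, ∫⁻ u in Ioc t T, ENNReal.ofReal (R t ω / R u ω * S u ω)
        ∂(hA ω).stieltjesFunction.measure ∂P := by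
  have hBm := 𝓕.le t B hB
  have hξ : Measurable[𝓕 t] (B.indicator fun ω => ENNReal.ofReal (R t ω)) :=
    Measurable.indicator (ENNReal.measurable_ofReal.comp (hR.stronglyAdapted t).measurable) hB
  have hRm : Measurable[𝓕.predictable] fun p : ℝ≥0 × Ω => ENNReal.ofReal (R p.1 p.2)⁻¹ :=
    ENNReal.measurable_ofReal.comp (measurable_inv.comp hR.measurable)
  have hH : Measurable[𝓕.predictable] fun p : ℝ≥0 × Ω =>
      (Ioi t).indicator (fun _ => B.indicator (fun ω => ENNReal.ofReal (R t ω)) p.2) p.1 *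
        ENNReal.ofReal (R p.1 p.2)⁻¹ :=
    (measurable_mul (M := ℝ≥0∞)).comp ((measurable_predictable_indicator_Ioi hξ).prodMk hRm)
  have h := hS.lintegral_predictable_eq (t := t) (T := T) hτ hAd hA hA0 hH
  rw [← lintegral_indicator hBm, ← lintegral_indicator hBm]
  have hR0 : ∀ u ω, ENNReal.ofReal (R t ω / R u ω) =
      ENNReal.ofReal (R t ω) * ENNReal.ofReal (R u ω)⁻¹ := fun u ω => by
    rw [div_eq_mul_inv, ENNReal.ofReal_mul (hRpos t ω).le]
  convert h using 3 with ω ω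
  · by_cases hω : ω ∈ B
    · rw [indicator_of_mem hω]
      refine setLIntegral_congr_fun measurableSet_Ioc fun u hu => ?_
      by_cases hτu : u < τ ω <;> simp [hu.1, hω, hτu, hR0]
    · simp [hω]
  · by_cases hω : ω ∈ B
    · rw [indicator_of_mem hω]
      refine setLIntegral_congr_fun measurableSet_Ioc fun u hu => ?_
      dsimp only
      rw [ENNReal.ofReal_mul (div_pos (hRpos t ω) (hRpos u ω)).le]
      simp [hu.1, hω, hR0]
    · simp [hω]

end Survival

/-! ### Bochner integrals against random Stieltjes measures -/

section Bochner

open ProbabilityTheory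

variable {Ω : Type*} {m : MeasurableSpace Ω} {P : Measure Ω}
  {κ : Kernel Ω ℝ≥0} {φ : ℝ≥0 → Ω → ℝ}

theorem ae_integral_kernel_eq (hφ : Measurable fun p : ℝ≥0 × Ω => φ p.1 p.2)
    (hφ0 : ∀ᵐ ω ∂P, ∀ u, 0 ≤ φ u ω) :
    (fun ω => ∫ u, φ u ω ∂κ ω) =ᵐ[P]
      fun ω => (∫⁻ u, ENNReal.ofReal (φ u ω) ∂κ ω).toReal := by
  filter_upwards [hφ0] with ω h0
  exact integral_eq_lintegral_of_nonneg_ae (Eventually.of_forall h0)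
    (hφ.comp measurable_prodMk_right).aestronglyMeasurable

variable [IsSFiniteKernel κ]

theorem measurable_lintegral_ofReal (hφ : Measurable fun p : ℝ≥0 × Ω => φ p.1 p.2) :
    Measurable fun ω => ∫⁻ u, ENNReal.ofReal (φ u ω) ∂κ ω :=
  Measurable.lintegral_kernel_prod_right (f := fun ω u => ENNReal.ofReal (φ u ω))
    (hφ.ennreal_ofReal.comp measurable_swap)

theorem ae_integrable_kernel (hφ : Measurable fun p : ℝ≥0 × Ω => φ p.1 p.2)
    (hφ0 : ∀ᵐ ω ∂P, ∀ u, 0 ≤ φ u ω)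
    (hfin : ∫⁻ ω, ∫⁻ u, ENNReal.ofReal (φ u ω) ∂κ ω ∂P ≠ ∞) :
    ∀ᵐ ω ∂P, Integrable (fun u => φ u ω) (κ ω) := by
  filter_upwards [ae_lt_top (measurable_lintegral_ofReal hφ) hfin, hφ0] with ω h h0
  refine ⟨(hφ.comp measurable_prodMk_right).aestronglyMeasurable, ?_⟩
  rw [hasFiniteIntegral_iff_ofReal (Eventually.of_forall h0)]
  exact h

theorem integrable_integral_kernel (hφ : Measurable fun p : ℝ≥0 × Ω => φ p.1 p.2)
    (hφ0 : ∀ᵐ ω ∂P, ∀ u, 0 ≤ φ u ω)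
    (hfin : ∫⁻ ω, ∫⁻ u, ENNReal.ofReal (φ u ω) ∂κ ω ∂P ≠ ∞) :
    Integrable (fun ω => ∫ u, φ u ω ∂κ ω) P :=
  (integrable_toReal_of_lintegral_ne_top (measurable_lintegral_ofReal hφ).aemeasurable hfin).congr
    (ae_integral_kernel_eq hφ hφ0).symm

theorem setIntegral_integral_kernel (hφ : Measurable fun p : ℝ≥0 × Ω => φ p.1 p.2)
    (hφ0 : ∀ᵐ ω ∂P, ∀ u, 0 ≤ φ u ω)
    (hfin : ∫⁻ ω, ∫⁻ u, ENNReal.ofReal (φ u ω) ∂κ ω ∂P ≠ ∞) (B : Set Ω) :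
    ∫ ω in B, ∫ u, φ u ω ∂κ ω ∂P = (∫⁻ ω in B, ∫⁻ u, ENNReal.ofReal (φ u ω) ∂κ ω ∂P).toReal := by
  rw [integral_congr_ae (ae_restrict_of_ae (ae_integral_kernel_eq hφ hφ0))]
  exact integral_toReal (measurable_lintegral_ofReal hφ).aemeasurable
    (ae_restrict_of_ae (ae_lt_top (measurable_lintegral_ofReal hφ) hfin))

end Bochner

/-! ### Exchanging the survival indicator for S in discounted integrals -/

section Discounted

variable {Ω : Type*} {m : MeasurableSpace Ω} {P : Measure Ω} [IsProbabilityMeasure P]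
  {𝓕 : Filtration ℝ≥0 m} {τ : Ω → ℝ≥0} {S : ℝ≥0 → Ω → ℝ} {A : ℝ≥0 → Ω → ℝ} {t T : ℝ≥0}
  {R : ℝ≥0 → Ω → ℝ}

theorem IsAzemaSupermartingale.integral_discounted (hS : IsAzemaSupermartingale P 𝓕 τ S)
    (hτ : Measurable τ) (hAd : StronglyAdapted 𝓕 A) (hA : ∀ ω, Monotone fun u => A u ω)
    (hA0 : ∀ u ω, 0 ≤ A u ω) (hR : IsStronglyPredictable 𝓕 R) (hRpos : ∀ u ω, 0 < R u ω)
    (hfin : ∫⁻ ω, ∫⁻ u in Ioc t T, ENNReal.ofReal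
        ({ω | u < τ ω}.indicator (fun _ => (1 : ℝ)) ω * (R t ω / R u ω))
        ∂(hA ω).stieltjesFunction.measure ∂P ≠ ∞) :
    (∀ᵐ ω ∂P, IntegrableOn (fun u => R t ω / R u ω * S u ω) (Ioc t T)
      (hA ω).stieltjesFunction.measure) ∧
    Integrable (fun ω => ∫ u in Ioc t T, {ω | u < τ ω}.indicator (fun _ => (1 : ℝ)) ω *
      (R t ω / R u ω) ∂(hA ω).stieltjesFunction.measure) P ∧
    Integrable (fun ω => ∫ u in Ioc t T, R t ω / R u ω * S u ω
      ∂(hA ω).stieltjesFunction.measure) P ∧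
    ∀ B, MeasurableSet[𝓕 t] B →
      ∫ ω in B, ∫ u in Ioc t T, R t ω / R u ω * S u ω ∂(hA ω).stieltjesFunction.measure ∂P =
      ∫ ω in B, ∫ u in Ioc t T, {ω | u < τ ω}.indicator (fun _ => (1 : ℝ)) ω *
        (R t ω / R u ω) ∂(hA ω).stieltjesFunction.measure ∂P := by
  have hRm : Measurable fun p : ℝ≥0 × Ω => R t p.2 / R p.1 p.2 :=
    (((hR.stronglyAdapted t).mono (𝓕.le t)).measurable.comp measurable_snd).div
      (hR.measurable.mono (predictable_le_prod 𝓕) le_rfl)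
  have h1m : Measurable fun p : ℝ≥0 × Ω =>
      {ω | p.1 < τ ω}.indicator (fun _ => (1 : ℝ)) p.2 * (R t p.2 / R p.1 p.2) :=
    Measurable.mul (measurable_const.indicator
      (measurableSet_lt measurable_fst (hτ.comp measurable_snd))) hRm
  have h2m : Measurable fun p : ℝ≥0 × Ω => R t p.2 / R p.1 p.2 * S p.1 p.2 :=
    hRm.mul hS.measurable_uncurry
  have h10 : ∀ᵐ ω ∂P, ∀ u, 0 ≤ {ω | u < τ ω}.indicator (fun _ => (1 : ℝ)) ω *
      (R t ω / R u ω) := Eventually.of_forall fun ω u =>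
    mul_nonneg (indicator_nonneg (by simp) _) (div_pos (hRpos t ω) (hRpos u ω)).le
  have h20 : ∀ᵐ ω ∂P, ∀ u, 0 ≤ R t ω / R u ω * S u ω := by
    filter_upwards [hS.ae_forall_mem_Icc hτ] with ω hω u
    exact mul_nonneg (div_pos (hRpos t ω) (hRpos u ω)).le (hω u).1
  have heq := fun B (hB : MeasurableSet[𝓕 t] B) =>
    hS.setLIntegral_discounted_eq (T := T) hτ hAd hA hA0 hR hRpos hB
  -- Integrability is assumed only up to default; the identity on the whole space transfers it to
  -- the integrand weighted by S.
  have hfin2 : ∫⁻ ω, ∫⁻ u in Ioc t T, ENNReal.ofReal (R t ω / R u ω * S u ω)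
      ∂(hA ω).stieltjesFunction.measure ∂P ≠ ∞ := by
    have h := heq univ (@MeasurableSet.univ _ (𝓕 t))
    rw [setLIntegral_univ, setLIntegral_univ] at h
    rwa [← h]
  refine ⟨ae_integrable_kernel (κ := stieltjesKernel A hAd hA t T)
      (φ := fun u ω => R t ω / R u ω * S u ω) h2m h20 hfin2,
    integrable_integral_kernel (κ := stieltjesKernel A hAd hA t T)
      (φ := fun u ω => {ω | u < τ ω}.indicator (fun _ => (1 : ℝ)) ω * (R t ω / R u ω))
      h1m h10 hfin,
    integrable_integral_kernel (κ := stieltjesKernel A hAd hA t T)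
      (φ := fun u ω => R t ω / R u ω * S u ω) h2m h20 hfin2, fun B hB => ?_⟩
  have e1 := setIntegral_integral_kernel (κ := stieltjesKernel A hAd hA t T)
      (φ := fun u ω => {ω | u < τ ω}.indicator (fun _ => (1 : ℝ)) ω * (R t ω / R u ω))
      h1m h10 hfin B
  have e2 := setIntegral_integral_kernel (κ := stieltjesKernel A hAd hA t T)
      (φ := fun u ω => R t ω / R u ω * S u ω) h2m h20 hfin2 B
  exact e2.trans ((congrArg ENNReal.toReal (heq B hB).symm).trans e1.symm)

end Discounted

/-! ### The value process -/

section StieltjesIntegral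

variable {Ω : Type*} {m₀ m : MeasurableSpace Ω} {P : Measure Ω} [IsProbabilityMeasure P]
  {𝓕 : Filtration ℝ≥0 m} {τ : Ω → ℝ≥0} {S : ℝ≥0 → Ω → ℝ} {t T : ℝ≥0}
  {R G : ℝ≥0 → Ω → ℝ}

/-- With V the variation function, (V - g) + (V + g) = 2V with both summands increasing, so d(V - g)
≤ 2 dV. Continuity of g is what lets right limits split over these sums. -/
theorem variationSubMeasure_le {g : ℝ≥0 → ℝ} (hg : LocallyBoundedVariationOn g univ)
    (hgc : Continuous g) :
    variationSubMeasure g hg ≤ variationMeasure g hg + variationMeasure g hg := by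
  have hV := monotoneOn_univ.mp (variationOnFromTo.monotoneOn hg (mem_univ 0))
  have hs := monotoneOn_univ.mp (variationOnFromTo.sub_self_monotoneOn hg (mem_univ 0))
  have ha := monotoneOn_univ.mp (variationOnFromTo.add_self_monotoneOn hg (mem_univ 0))
  have h : hs.stieltjesFunction + ha.stieltjesFunction
      = hV.stieltjesFunction + hV.stieltjesFunction := by
    ext x
    have hgx : Tendsto g (𝓝[>] x) (𝓝 (g x)) := (hgc.tendsto x).mono_left nhdsWithin_le_nhds
    have e1 : Tendsto (variationOnFromTo g univ 0 - g) (𝓝[>] x)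
        (𝓝 (Function.rightLim (variationOnFromTo g univ 0) x - g x)) :=
      (hV.tendsto_rightLim x).sub hgx
    have e2 : Tendsto (variationOnFromTo g univ 0 + g) (𝓝[>] x)
        (𝓝 (Function.rightLim (variationOnFromTo g univ 0) x + g x)) :=
      (hV.tendsto_rightLim x).add hgx
    simp only [StieltjesFunction.add_apply, Monotone.stieltjesFunction_eq]
    rw [tendsto_nhds_unique (hs.tendsto_rightLim x) e1,
      tendsto_nhds_unique (ha.tendsto_rightLim x) e2]
    ring
  change hs.stieltjesFunction.measure ≤ hV.stieltjesFunction.measure + hV.stieltjesFunction.measure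
  rw [← StieltjesFunction.measure_add, ← h, StieltjesFunction.measure_add]
  exact Measure.le_add_right le_rfl

/-- Integrals against the finite variation process `G` up to default. -/
theorem IsAzemaSupermartingale.stieltjesIntegral_discounted
    (hS : IsAzemaSupermartingale P 𝓕 τ S) (hτ : Measurable τ)
    (hG : ∀ ω, LocallyBoundedVariationOn (fun u => G u ω) univ)
    (hGa : StronglyAdapted 𝓕 G) (hGc : ∀ ω, Continuous fun u => G u ω) (hG0 : ∀ ω, G 0 ω = 0)
    (hR : IsStronglyPredictable 𝓕 R) (hRpos : ∀ u ω, 0 < R u ω)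
    (hfin : ∫⁻ ω, ∫⁻ u in Ioc t T, {u | u < τ ω}.indicator
      (fun u => ENNReal.ofReal (R t ω / R u ω)) u
      ∂(variationMeasure (fun u => G u ω) (hG ω)) ∂P < ∞) :
    (∀ᵐ ω ∂P, IntegrableOn (fun u => R t ω / R u ω * S u ω) (Ioc t T)
      (variationMeasure (fun u => G u ω) (hG ω))) ∧
    Integrable (fun ω => stieltjesIntegral (fun u => G u ω) (hG ω) t T fun u =>
      {ω | u < τ ω}.indicator (fun _ => (1 : ℝ)) ω * (R t ω / R u ω)) P ∧
    Integrable (fun ω => stieltjesIntegral (fun u => G u ω) (hG ω) t T fun u =>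
      R t ω / R u ω * S u ω) P ∧
    ∀ B, MeasurableSet[𝓕 t] B →
      ∫ ω in B, stieltjesIntegral (fun u => G u ω) (hG ω) t T (fun u =>
        R t ω / R u ω * S u ω) ∂P =
      ∫ ω in B, stieltjesIntegral (fun u => G u ω) (hG ω) t T (fun u =>
        {ω | u < τ ω}.indicator (fun _ => (1 : ℝ)) ω * (R t ω / R u ω)) ∂P := by
  have hA1 : ∀ ω, Monotone fun u => variationOnFromTo (fun v => G v ω) univ 0 u := fun ω =>
    monotoneOn_univ.mp (variationOnFromTo.monotoneOn (hG ω) (mem_univ 0))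
  have hA2 : ∀ ω, Monotone fun u => variationOnFromTo (fun v => G v ω) univ 0 u - G u ω := fun ω =>
    monotoneOn_univ.mp (variationOnFromTo.sub_self_monotoneOn (hG ω) (mem_univ 0))
  have hd1 : StronglyAdapted 𝓕 fun u ω => variationOnFromTo (fun v => G v ω) univ 0 u :=
    stronglyAdapted_variationOnFromTo hGa hGc
  have hd2 : StronglyAdapted 𝓕 fun u ω => variationOnFromTo (fun v => G v ω) univ 0 u - G u ω :=
    fun u => (hd1 u).sub (hGa u)
  have h01 : ∀ u ω, 0 ≤ variationOnFromTo (fun v => G v ω) univ 0 u := fun u ω =>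
    variationOnFromTo.nonneg_of_le _ _ zero_le
  -- V - G is increasing and vanishes at 0 because G₀ = 0; nonnegativity is needed for the
  -- localisation by levels.
  have h02 : ∀ u ω, 0 ≤ variationOnFromTo (fun v => G v ω) univ 0 u - G u ω := fun u ω => by
    have h := hA2 ω (zero_le (a := u))
    simpa [variationOnFromTo.self, hG0] using h
  have hle : ∀ ω, ∫⁻ u in Ioc t T, ENNReal.ofReal
      ({ω | u < τ ω}.indicator (fun _ => (1 : ℝ)) ω * (R t ω / R u ω))
      ∂(variationMeasure (fun u => G u ω) (hG ω)) = ∫⁻ u in Ioc t T, {u | u < τ ω}.indicator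
      (fun u => ENNReal.ofReal (R t ω / R u ω)) u
      ∂(variationMeasure (fun u => G u ω) (hG ω)) := fun ω => by
    refine lintegral_congr fun u => ?_
    by_cases h : u < τ ω <;> simp [h]
  have hfin1 : ∫⁻ ω, ∫⁻ u in Ioc t T, ENNReal.ofReal
      ({ω | u < τ ω}.indicator (fun _ => (1 : ℝ)) ω * (R t ω / R u ω))
      ∂(variationMeasure (fun u => G u ω) (hG ω)) ∂P ≠ ∞ := by
    simp only [hle]
    exact hfin.ne
  have hfin2 : ∫⁻ ω, ∫⁻ u in Ioc t T, ENNReal.ofReal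
      ({ω | u < τ ω}.indicator (fun _ => (1 : ℝ)) ω * (R t ω / R u ω))
      ∂(variationSubMeasure (fun u => G u ω) (hG ω)) ∂P ≠ ∞ := by
    refine ne_top_of_le_ne_top (ENNReal.mul_ne_top (ENNReal.ofNat_ne_top (n := 2)) hfin1) ?_
    rw [← lintegral_const_mul' _ _ ENNReal.ofNat_ne_top]
    refine lintegral_mono fun ω => ?_
    dsimp only
    rw [two_mul, ← lintegral_add_measure, ← Measure.restrict_add]
    exact lintegral_mono' (Measure.restrict_mono le_rfl (variationSubMeasure_le (hG ω) (hGc ω)))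
      le_rfl
  obtain ⟨a1, b1, c1, d1⟩ := hS.integral_discounted hτ hd1 hA1 h01 hR hRpos hfin1
  obtain ⟨-, b2, c2, d2⟩ := hS.integral_discounted hτ hd2 hA2 h02 hR hRpos hfin2
  refine ⟨a1, b1.sub b2, c1.sub c2, fun B hB => ?_⟩
  exact (integral_sub c1.integrableOn c2.integrableOn).trans
    ((congrArg₂ _ (d1 B hB) (d2 B hB)).trans (integral_sub b1.integrableOn b2.integrableOn).symm)

theorem condExp_ae_eq_of_setIntegral_eq (hm : m₀ ≤ m) {X Y : Ω → ℝ}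
    (hX : Integrable X P) (hY : Integrable Y P)
    (h : ∀ B, MeasurableSet[m₀] B → ∫ ω in B, X ω ∂P = ∫ ω in B, Y ω ∂P) :
    P[X | m₀] =ᵐ[P] P[Y | m₀] :=
  ae_eq_condExp_of_forall_setIntegral_eq hm hY
    (fun _ _ _ => integrable_condExp.integrableOn)
    (fun B hB _ => (setIntegral_condExp hm hX hB).trans (h B hB))
    stronglyMeasurable_condExp.aestronglyMeasurable

/-- On {τ > t} this is a regrouping of R_t. Off this event every u in (t,T] exceeds τ and T ≥ t ≥ τ,
so all three terms vanish. -/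
theorem indicator_discountedCashFlow_eq {C : Ω → ℝ} {Z : ℝ≥0 → Ω → ℝ}
    (hG : ∀ ω, LocallyBoundedVariationOn (fun u => G u ω) univ) (htT : t ≤ T) :
    {ω | t < τ ω}.indicator (discountedCashFlow τ R C G hG Z T t) = fun ω =>
      {ω | T < τ ω}.indicator (fun ω => R t ω / R T ω * C ω) ω +
      stieltjesIntegral (fun u => G u ω) (hG ω) t T (fun u =>
        {ω | u < τ ω}.indicator (fun _ => (1 : ℝ)) ω * (R t ω / R u ω)) +
      {ω | t < τ ω ∧ τ ω ≤ T}.indicator (fun ω => R t ω / R (τ ω) ω * Z (τ ω) ω) ω := by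
  ext ω
  by_cases h : t < τ ω
  · have hint : stieltjesIntegral (fun u => G u ω) (hG ω) t T (fun u =>
        {ω | u < τ ω}.indicator (fun _ => (1 : ℝ)) ω * (R t ω / R u ω)) =
        R t ω * stieltjesIntegral (fun u => G u ω) (hG ω) t T (fun u =>
          {ω | u < τ ω}.indicator (fun _ => (1 : ℝ)) ω * (R u ω)⁻¹) := by
      have he : ∀ u, {ω | u < τ ω}.indicator (fun _ => (1 : ℝ)) ω * (R t ω / R u ω) =
          R t ω * ({ω | u < τ ω}.indicator (fun _ => (1 : ℝ)) ω * (R u ω)⁻¹) := fun u => by ring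
      simp only [stieltjesIntegral, he, integral_const_mul, mul_sub]
    rw [hint, indicator_of_mem (show ω ∈ {ω | t < τ ω} from h), discountedCashFlow]
    by_cases h' : T < τ ω
    · have h'' : ¬ τ ω ≤ T := not_le.mpr h'
      simp only [indicator, mem_ofPred_eq, h', h'', if_true, if_false, and_false]
      ring
    · have h'' : τ ω ≤ T := not_lt.mp h'
      simp only [indicator, mem_ofPred_eq, h, h', h'', if_true, if_false, and_self]
      ring
  · have h0 : ∀ μ : Measure ℝ≥0, ∫ u in Ioc t T, {ω | u < τ ω}.indicator (fun _ => (1 : ℝ)) ω *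
        (R t ω / R u ω) ∂μ = 0 := fun μ => by
      refine (setIntegral_congr_fun (g := fun _ => (0 : ℝ)) measurableSet_Ioc fun u hu => ?_).trans
        (integral_zero _ _)
      have hu' : ¬ u < τ ω := fun h' => h (hu.1.trans h')
      simp [hu']
    have h' : ¬ T < τ ω := fun h' => h (htT.trans_lt h')
    simp [h, h', stieltjesIntegral, h0]

end StieltjesIntegral

end DelayedInfo

/-! ### Pre-default conditional expectations and the value of the claim -/

theorem mainTheorem6 {Ω : Type*} {m : MeasurableSpace Ω} (P : Measure Ω) [IsProbabilityMeasure P]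
    (𝓕 : Filtration ℝ≥0 m)
    (τ : Ω → ℝ≥0) (hτ : Measurable τ) (hτpos : ∀ ω, 0 < τ ω)
    (δ : ℝ≥0 → ℝ≥0) (hδ : ∀ t, δ t ≤ t) (hδmono : Monotone fun t => t - δ t)
    (S : ℝ≥0 → Ω → ℝ) (hS : DelayedInfo.IsAzemaSupermartingale P 𝓕 τ S) :
    -- the denominator `E[S_t | 𝓕ᴰ_t]` is positive before default
    (∀ t : ℝ≥0, ∀ᵐ ω ∂P, t < τ ω →
      0 < (P[S t | DelayedInfo.delayedFiltration 𝓕 δ hδmono t]) ω) ∧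
    -- conditional expectations given `𝓖ᴰ_t`, integrable case
    (∀ t θ : ℝ≥0, t ≤ θ → ∀ φ : Ω → ℝ, StronglyMeasurable[𝓕 θ] φ →
      Integrable ({ω | θ < τ ω}.indicator φ) P →
      Integrable (fun ω => φ ω * S θ ω) P ∧
      P[{ω | θ < τ ω}.indicator φ | DelayedInfo.investorFiltration 𝓕 δ hδmono τ hτ t] =ᵐ[P]
        {ω | t < τ ω}.indicator (fun ω =>
          (P[fun ω' => φ ω' * S θ ω' | DelayedInfo.delayedFiltration 𝓕 δ hδmono t]) ω /
            (P[S t | DelayedInfo.delayedFiltration 𝓕 δ hδmono t]) ω)) ∧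
    -- conditional expectations given `𝓖ᴰ_t`, nonnegative case
    (∀ t θ : ℝ≥0, t ≤ θ → ∀ φ : Ω → ℝ≥0∞, Measurable[𝓕 θ] φ →
      condLExp (DelayedInfo.investorFiltration 𝓕 δ hδmono τ hτ t) P
          ({ω | θ < τ ω}.indicator φ) =ᵐ[P]
        {ω | t < τ ω}.indicator (fun ω =>
          condLExp (DelayedInfo.delayedFiltration 𝓕 δ hδmono t) P
              (fun ω' => φ ω' * ENNReal.ofReal (S θ ω')) ω /
            condLExp (DelayedInfo.delayedFiltration 𝓕 δ hδmono t) P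
              (fun ω' => ENNReal.ofReal (S t ω')) ω)) ∧
    -- the value process
    (∀ (T : ℝ≥0) (R : ℝ≥0 → Ω → ℝ), IsStronglyPredictable 𝓕 R → (∀ u ω, 0 < R u ω) →
      ∀ C : Ω → ℝ, StronglyMeasurable[𝓕 T] C →
      ∀ (G : ℝ≥0 → Ω → ℝ) (hG : ∀ ω, LocallyBoundedVariationOn (fun u => G u ω) univ),
      StronglyAdapted 𝓕 G → (∀ ω, Continuous fun u => G u ω) → (∀ ω, G 0 ω = 0) →
      ∀ Z : ℝ≥0 → Ω → ℝ, IsStronglyPredictable 𝓕 Z →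
      ∀ t : ℝ≥0, t ≤ T →
      -- the three terms of the discounted cash flow are integrable on `{τ > t}`
      Integrable ({ω | T < τ ω}.indicator fun ω => R t ω / R T ω * C ω) P →
      (∫⁻ ω, ∫⁻ u in Ioc t T, {u | u < τ ω}.indicator
          (fun u => ENNReal.ofReal (R t ω / R u ω)) u
          ∂(DelayedInfo.variationMeasure (fun u => G u ω) (hG ω)) ∂P < ∞) →
      Integrable ({ω | t < τ ω ∧ τ ω ≤ T}.indicator
        fun ω => R t ω / R (τ ω) ω * Z (τ ω) ω) P →
      -- `I` is the stochastic integral `∫_t^T (R_t / R_u) Z_u dS_u`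
      ∀ I : Ω → ℝ, DelayedInfo.HasStochIntegral P 𝓕 S t T
        (fun u ω => R t ω / R u ω * Z u ω) I →
      Integrable ({ω | t < τ ω}.indicator
        (DelayedInfo.discountedCashFlow τ R C G hG Z T t)) P ∧
      (∀ᵐ ω ∂P, IntegrableOn (fun u => R t ω / R u ω * S u ω) (Ioc t T)
        (DelayedInfo.variationMeasure (fun u => G u ω) (hG ω))) ∧
      Integrable (fun ω => R t ω / R T ω * S T ω * C ω
        + DelayedInfo.stieltjesIntegral (fun u => G u ω) (hG ω) t T
            (fun u => R t ω / R u ω * S u ω) - I ω) P ∧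
      DelayedInfo.valueProcess P (DelayedInfo.investorFiltration 𝓕 δ hδmono τ hτ)
          τ R C G hG Z T t =ᵐ[P]
        {ω | t < τ ω}.indicator (fun ω =>
          ((P[S t | DelayedInfo.delayedFiltration 𝓕 δ hδmono t]) ω)⁻¹ *
            (P[fun ω' => R t ω' / R T ω' * S T ω' * C ω'
                + DelayedInfo.stieltjesIntegral (fun u => G u ω') (hG ω') t T
                    (fun u => R t ω' / R u ω' * S u ω') - I ω'
              | DelayedInfo.delayedFiltration 𝓕 δ hδmono t]) ω)) := by
  refine ⟨fun t => hS.condExp_delayedFiltration_pos hτ t, fun t θ htθ φ hφ hint =>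
    ⟨hS.integrable_mul hτ hφ hint, hS.condExp_indicator_investorFiltration hτ htθ hφ hint⟩,
    fun t θ htθ φ hφ => hS.condLExp_indicator_investorFiltration hτ htθ hφ, ?_⟩
  intro T R hR hRpos C hC G hG hGa hGc hG0 Z hZ t htT hCint hGfin hZint I hI
  have hφ : StronglyMeasurable[𝓕 T] fun ω => R t ω / R T ω * C ω :=
    ((((hR.stronglyAdapted t).mono (𝓕.mono htT)).measurable.div
      (hR.stronglyAdapted T).measurable).mul hC.measurable).stronglyMeasurable
  have hCS := hS.integrable_mul hτ hφ hCint
  have hCY : ∀ ω, R t ω / R T ω * S T ω * C ω = R t ω / R T ω * C ω * S T ω := fun ω =>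
    mul_right_comm _ _ _
  obtain ⟨hae, hXb, hYb, hb⟩ := hS.stieltjesIntegral_discounted hτ hG hGa hGc hG0 hR hRpos hGfin
  have hX := (hCint.add hXb).add hZint
  have hY := (hCS.add hYb).sub hI.1
  rw [DelayedInfo.valueProcess, DelayedInfo.indicator_discountedCashFlow_eq hG htT]
  simp only [hCY]
  refine ⟨hX, hae, hY, (hS.condExp_investorFiltration hτ t hX fun ω hω => ?_).trans ?_⟩
  · have h := congrFun (DelayedInfo.indicator_discountedCashFlow_eq (τ := τ) (R := R) (C := C)
      (Z := Z) hG htT) ω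
    exact h.symm.trans (indicator_of_notMem (s := {ω | t < τ ω}) hω _)
  · have hle := DelayedInfo.delayedFiltration_le (𝓕 := 𝓕) (hδ := hδmono) t
    have hN := DelayedInfo.condExp_ae_eq_of_setIntegral_eq (hle.trans (𝓕.le t)) hX hY
      fun B hB => ?_
    · filter_upwards [hN] with ω h
      by_cases hω : t < τ ω
      · rw [indicator_of_mem (s := {ω | t < τ ω}) hω, indicator_of_mem (s := {ω | t < τ ω}) hω,
          div_eq_inv_mul]
        exact congrArg _ h
      · rw [indicator_of_notMem (s := {ω | t < τ ω}) hω,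
          indicator_of_notMem (s := {ω | t < τ ω}) hω]
    · have hBt := hle B hB
      refine (integral_add (hCint.add hXb).integrableOn hZint.integrableOn).trans ?_
      refine Eq.trans ?_ (integral_sub (hCS.add hYb).integrableOn hI.1.integrableOn).symm
      -- Over an 𝓕_t-set, subtracting the stochastic integral amounts to adding the recovery
      -- payment, so both sides now share that summand; the dividend and terminal terms remain.
      rw [hI.setIntegral_eq hS hτ hZint hBt, sub_neg_eq_add]
      refine congrArg (· + _) ?_
      refine (integral_add hCint.integrableOn hXb.integrableOn).trans ?_
      refine Eq.trans ?_ (integral_add hCS.integrableOn hYb.integrableOn).symm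
      rw [hb B hBt, hS.setIntegral_mul hτ hφ hCint (𝓕.mono htT B hBt)]
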